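/- Let $\mathcal G$ be an undirected connected graph without self-loops on the agents $\{1,\dots,n\}$, with neighbour sets $\mathcal N_i$, degrees $d_i=|\mathcal N_i|$, degree matrix $D$ and adjacency matrix $W$. Suppose that $L_u=D+W$ is positive definite. Let $\hat\lambda_1$ be the smallest eigenvalue of $L_u$ and $\lambda_n$ the largest eigenvalue of $L=D-W$. For $i=1,\dots,n$ let $f_i:\mathbb R^d\to\mathbb R$ be twice differentiable, and suppose that for some $v_i>0$ and $\ell_i$, for all $x,x'\in\mathbb R^d$, $\langle\nabla f_i(x')-\nabla f_i(x),x'-x\rangle\ge v_i\|x'-x\|^2$ and $\|\nabla f_i(x')-\nabla f_i(x)\|\le\ell_i\|x'-x\|$. Put $v=\min_i v_i$ and $\ell=\max_i\ell_i$. Let $\mathcal C$ be a (measurable) random map $\mathbb R^d\to\mathbb R^d$ that is $\delta$-contractive for some $0\le\delta<1$, i.e. $\mathbb E\|x-\mathcal C(x)\|^2\le\delta\|x\|^2$ for all $x$, and unbiased, i.e. $\mathbb E\,\mathcal C(x)=x$ for all $x$. Given $c>0$ and thresholds $\mu_k$, the algorithm CC-DQM starts from arbitrary, possibly random, square-integrable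 $x_{i,0}$ and from $y_{i,0}=\varphi_{i,0}=0$, and iterates, for $k=0,1,2,\dots$ and all $i$, $$x_{i,k+1}=x_{i,k}-\bigl(2cd_iI+\nabla^2f_i(y_{i,k})\bigr)^{-1}\Bigl(\nabla f_i(x_{i,k})+c\sum_{j\in\mathcal N_i}(y_{i,k}-y_{j,k})+\varphi_{i,k}\Bigr),$$ $$y_{i,k+1}=\begin{cases}y_{i,k}+\mathcal C(x_{i,k+1}-y_{i,k})&\text{if }\|x_{i,k+1}-y_{i,k}\|\ge\mu_k,\\ y_{i,k}&\text{otherwise,}\end{cases}\qquad \varphi_{i,k+1}=\varphi_{i,k}+c\sum_{j\in\mathcal N_i}(y_{i,k+1}-y_{j,k+1}),$$ where the randomness that each agent uses for its compression in iteration $k$ is independent of the initial points and of all compressions in earlier iterations. Suppose that $\mu_k=0$ for all $k$ and that $$\frac{\delta}{(1-\sqrt\delta)^2}<\frac{\hat\lambda_1}{3\lambda_n}\qquad\text{and}\qquad c>\frac{\ell^2}{v}\cdot\frac{2(1-\sqrt\delta)^2}{\hat\lambda_1(1-\sqrt\delta)^2-3\lambda_n\delta}.$$ Then $\sum_{i=1}^nf_i$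 has a unique minimizer $x^*$, and CC-DQM converges linearly in expectation to it: there is $\sigma\in(0,1)$, not depending on the initial points, such that for every run of the algorithm there is a constant $K$ with $$\|\mathbb E(x_{i,k})-x^*\|\le K\sigma^k\qquad\text{and}\qquad \mathbb E\|x_{i,k}-x^*\|^2\le K\sigma^k\qquad\text{for all }i\text{ and all }k\ge0 .$$ -/

import Mathlib

open MeasureTheory ProbabilityTheory

universe u w

noncomputable section

namespace CCDQM

/-- The decision space `ℝ^d` with its Euclidean norm. -/
abbrev Vec (d : ℕ) : Type := EuclideanSpace ℝ (Fin d)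

section Graph

variable {n : ℕ} (G : SimpleGraph (Fin n)) [DecidableRel G.Adj]

/-- The unsigned (signless) Laplacian `D + W`; the signed one, `D - W`, is `G.lapMatrix ℝ`. -/
def unsignedLap : Matrix (Fin n) (Fin n) ℝ := G.degMatrix ℝ + G.adjMatrix ℝ

theorem lap_isHermitian : (G.lapMatrix ℝ).IsHermitian :=
  (SimpleGraph.posSemidef_lapMatrix ℝ G).isHermitian

theorem unsignedLap_isHermitian : (unsignedLap G).IsHermitian := by
  have h1 : (G.degMatrix ℝ).IsHermitian := Matrix.isHermitian_diagonal _
  have h2 : (G.adjMatrix ℝ).IsHermitian := by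
    rw [Matrix.IsHermitian, Matrix.conjTranspose_eq_transpose_of_trivial]
    exact SimpleGraph.transpose_adjMatrix (α := ℝ) G
  exact h1.add h2

/-- `λ_n`: the largest eigenvalue of the signed Laplacian. -/
def lapEigMax : ℝ := ⨆ i, (lap_isHermitian G).eigenvalues i

/-- `λ̂_1`: the smallest eigenvalue of the unsigned Laplacian. -/
def unsignedLapEigMin : ℝ := ⨅ i, (unsignedLap_isHermitian G).eigenvalues i

end Graph

section Objective

variable {d : ℕ}

/-- The Hessian `∇² f (y)`, as the derivative of the gradient. -/
def hessian (f : Vec d → ℝ) (y : Vec d) : Vec d →L[ℝ] Vec d := fderiv ℝ (gradient f) y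

/-- `f` is twice differentiable, `v`-strongly convex, and has an `ℓ`-Lipschitz gradient. -/
structure StronglyConvexSmooth (f : Vec d → ℝ) (v ℓ : ℝ) : Prop where
  differentiable : Differentiable ℝ f
  differentiable_gradient : Differentiable ℝ (gradient f)
  modulus_pos : 0 < v
  strong : ∀ x x' : Vec d,
    v * ‖x' - x‖ ^ 2 ≤ inner ℝ (gradient f x' - gradient f x) (x' - x)
  lipschitz : ∀ x x' : Vec d, ‖gradient f x' - gradient f x‖ ≤ ℓ * ‖x' - x‖

/-- `z` minimizes `∑ i, f i` over `ℝ^d`. -/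
def IsOptimal {n : ℕ} (f : Fin n → Vec d → ℝ) (z : Vec d) : Prop :=
  ∀ x, ∑ i, f i z ≤ ∑ i, f i x

end Objective

section Compressor

variable {d : ℕ} {S : Type*} [MeasurableSpace S]

/-- A randomized compressor is a jointly measurable map `C : S → ℝ^d → ℝ^d`, where the seed `s : S`
has law `ν`. It is `δ`-contractive if `0 ≤ δ < 1` and `𝔼 ‖x - C x‖² ≤ δ ‖x‖²` for all `x`. -/
structure IsContractive (ν : Measure S) (C : S → Vec d → Vec d) (δ : ℝ) : Prop where
  measurable : Measurable (fun p : S × Vec d => C p.1 p.2)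
  nonneg : 0 ≤ δ
  lt_one : δ < 1
  integrable : ∀ x, Integrable (fun s => ‖x - C s x‖ ^ 2) ν
  contractive : ∀ x, ∫ s, ‖x - C s x‖ ^ 2 ∂ν ≤ δ * ‖x‖ ^ 2

/-- The compressor is unbiased: `𝔼 (C x) = x` for all `x`. -/
def IsUnbiased (ν : Measure S) (C : S → Vec d → Vec d) : Prop :=
  ∀ x, Integrable (fun s => C s x) ν ∧ ∫ s, C s x ∂ν = x

end Compressor

section Algorithm

variable {n d : ℕ} {S : Type*}

/-- The variables of all agents: decision variables `x_i`, estimates `y_i`, dual variables `φ_i`. -/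
structure State (n d : ℕ) where
  x : Fin n → Vec d
  y : Fin n → Vec d
  φ : Fin n → Vec d

variable (G : SimpleGraph (Fin n)) [DecidableRel G.Adj] (f : Fin n → Vec d → ℝ) (c : ℝ)
  (C : S → Vec d → Vec d)

/-- The primal update
`x_i - (2 c d_i I + ∇² f_i(y_i))⁻¹ (∇ f_i(x_i) + c ∑_{j ∈ N_i} (y_i - y_j) + φ_i)`. -/
def nextX (z : State n d) (i : Fin n) : Vec d :=
  z.x i -
    (((2 * c * (G.degree i : ℝ)) • ContinuousLinearMap.id ℝ (Vec d)
        + hessian (f i) (z.y i)).inverse)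
      (gradient (f i) (z.x i) + c • ∑ j ∈ G.neighborFinset i, (z.y i - z.y j) + z.φ i)

open Classical in
/-- The update of the estimate, with censoring threshold `μ` and seed `s i` for agent `i`: the
compressed innovation is transmitted exactly when the innovation is at least the threshold. -/
def nextY (μ : ℝ) (s : Fin n → S) (z : State n d) (i : Fin n) : Vec d :=
  if μ ≤ ‖nextX G f c z i - z.y i‖ then
    C (s i) (nextX G f c z i - z.y i) + z.y i
  else z.y i

/-- The dual update `φ_i + c ∑_{j ∈ N_i} (y_i⁺ - y_j⁺)`, with the updated estimates. -/
def nextφ (μ : ℝ) (s : Fin n → S) (z : State n d) (i : Fin n) : Vec d :=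
  z.φ i + c • ∑ j ∈ G.neighborFinset i, (nextY G f c C μ s z i - nextY G f c C μ s z j)

/-- CC-DQM with thresholds `μ k`, started at `x_{i,0} = x0 i`, `y_{i,0} = 0`, `φ_{i,0} = 0`;
`s k i` is the seed that agent `i` uses for its compression in iteration `k`. -/
def run (μ : ℕ → ℝ) (x0 : Fin n → Vec d) (s : ℕ → Fin n → S) : ℕ → State n d
  | 0 => ⟨x0, fun _ => 0, fun _ => 0⟩
  | k + 1 =>
    let z := run μ x0 s k
    ⟨nextX G f c z, nextY G f c C (μ k) (s k) z, nextφ G f c C (μ k) (s k) z⟩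

end Algorithm

/-- The random inputs of the algorithm: a square-integrable initial point (possibly deterministic),
and seeds of law `ν` which are fresh, i.e. independent of everything that happened before they are
drawn. Here `ℱ k` is the information available before the compressions of iteration `k`. The seeds
of different agents in the same iteration may depend on each other. -/
structure IsRandomInput {n d : ℕ} {S : Type*} [MeasurableSpace S] (ν : Measure S)
    {Ω : Type*} [mΩ : MeasurableSpace Ω] (P : Measure Ω) (ℱ : Filtration ℕ mΩ)
    (x0 : Fin n → Ω → Vec d) (ξ : ℕ → Fin n → Ω → S) : Prop where
  init_measurable : ∀ i, Measurable[ℱ 0] (x0 i)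
  init_memLp : ∀ i, MemLp (x0 i) 2 P
  seed_measurable : ∀ k i, Measurable[ℱ (k + 1)] (ξ k i)
  seed_law : ∀ k i, P.map (ξ k i) = ν
  seed_fresh : ∀ k i, Indep (MeasurableSpace.comap (ξ k i) inferInstance) (ℱ k) P

end CCDQM

end

/-! Stack the agents' variables and write `L`, `U` for the signed and unsigned Laplacians acting on
the stack. Since φ_k = c L p_k with p_k the sum of the estimates y_0, ..., y_k, and since 2D = L +
U, the primal update is an implicit linear relation between consecutive states (`nextX_equation`).
The gradients at the minimizer sum to zero, so on a connected graph they lie in the range of `L`;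
this supplies a dual optimum, which is subtracted from p.

The Lyapunov function is V = (c/2)⟨U(x - x*), x - x*⟩ + (c/2)⟨Lp, p⟩ + θ‖y - x‖², where p is now the
centred sum. Pairing the update with x' - x* gives an exact energy balance
(`primal_dual_energy_identity`). The error of the linearized gradient costs at most 2ℓ‖x' - x‖‖x' -
x*‖, and is absorbed by strong convexity and by the U-form of x' - x exactly when a binary quadratic
form is positive definite; this is the lower bound on c. The condition on δ makes the coefficient of
‖x' - x‖² in that form positive after paying for compression.

Two terms of the balance have no sign pointwise. Contractivity makes the expectation of ‖y' - x'‖² -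
δ‖x' - y‖² nonpositive, and unbiasedness makes that of ⟨L(x' + p), y' - x'⟩ zero, because x' and p
are known before the seed is drawn. As V' is bounded by the quantities that decrease
(`exists_lyapunov_le`), 𝔼V decays geometrically (`exists_lyapunov_contraction`,
`integral_lyapunov_contraction`, `exists_rate`). Positivity of the smallest eigenvalue of `U` turns
this into mean-square convergence, and the bias follows from the second moment. -/

/-! ### Scalar inequalities. -/

theorem exists_pos_quadratic_lower_bound {v A l : ℝ} (hv : 0 < v) (hA : l ^ 2 < v * A) :
    ∃ κ : ℝ, 0 < κ ∧ ∀ X D : ℝ, κ * (X ^ 2 + D ^ 2) ≤ v * X ^ 2 - 2 * l * (X * D) + A * D ^ 2 := by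
  have hApos : 0 < A := by
    by_contra h
    nlinarith [sq_nonneg l, mul_nonneg hv.le (not_lt.1 h |> neg_nonneg.2)]
  -- Determinant over trace of the form. With this κ, (v - κ)(A - κ) = l² + κ², so the form shifted
  -- by κ is still nonnegative, by completing the square.
  refine ⟨(v * A - l ^ 2) / (v + A), div_pos (by linarith) (by linarith), fun X D => ?_⟩
  set κ := (v * A - l ^ 2) / (v + A) with hκ
  have hmul : κ * (v + A) = v * A - l ^ 2 := by rw [hκ]; field_simp
  have hlt : 0 < v - κ := by
    have : (v - κ) * (v + A) = v ^ 2 + l ^ 2 := by linear_combination -hmul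
    by_contra h
    nlinarith [sq_nonneg l, mul_nonneg (not_lt.1 h |> neg_nonneg.2) (by linarith : 0 ≤ v + A),
      pow_pos hv 2]
  have key : (v - κ) * ((v - κ) * X ^ 2 - 2 * l * (X * D) + (A - κ) * D ^ 2)
      = ((v - κ) * X - l * D) ^ 2 + (κ * D) ^ 2 := by linear_combination (-D ^ 2) * hmul
  have h0 : 0 ≤ (v - κ) * X ^ 2 - 2 * l * (X * D) + (A - κ) * D ^ 2 := by
    refine nonneg_of_mul_nonneg_right ?_ hlt
    rw [key]; positivity
  linarith

/-- The scalar bound on the compression error behind the contraction of the estimates. -/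
theorem mul_sq_norm_sub_le {H : Type*} [NormedAddCommGroup H] {s : ℝ} (hs0 : 0 ≤ s) (hs1 : s < 1) (D r : H) :
    s ^ 2 * ‖D - r‖ ^ 2 ≤ s * ‖r‖ ^ 2 + s ^ 2 / (1 - s) * ‖D‖ ^ 2 := by
  have h1 : 0 < 1 - s := by linarith
  have h2 : ‖D - r‖ ^ 2 ≤ (‖D‖ + ‖r‖) ^ 2 := by gcongr; exact norm_sub_le _ _
  have h3 : s * ‖r‖ ^ 2 + s ^ 2 / (1 - s) * ‖D‖ ^ 2 - s ^ 2 * (‖D‖ + ‖r‖) ^ 2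
      = s / (1 - s) * (s * ‖D‖ - (1 - s) * ‖r‖) ^ 2 := by field_simp; ring
  have h4 : 0 ≤ s / (1 - s) * (s * ‖D‖ - (1 - s) * ‖r‖) ^ 2 := by positivity
  have h5 := mul_le_mul_of_nonneg_left h2 (sq_nonneg s)
  linarith

theorem sq_add_four_le (a b d e : ℝ) :
    (a + b + d + e) ^ 2 ≤ 4 * (a ^ 2 + b ^ 2 + d ^ 2 + e ^ 2) := by
  nlinarith [sq_nonneg (a - b), sq_nonneg (a - d), sq_nonneg (a - e), sq_nonneg (b - d),
    sq_nonneg (b - e), sq_nonneg (d - e)]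

/-! ### The energy balance and the Lyapunov contraction in an abstract inner product space. -/

section InnerProduct

variable {H : Type*} [NormedAddCommGroup H] [InnerProductSpace ℝ H]

/-- The quadratic form of a symmetric operator in finite dimension is controlled by the square of
its image. -/
theorem exists_inner_le_sq_norm_image [FiniteDimensional ℝ H] (T : H →L[ℝ] H)
    (hT : ∀ a b, inner ℝ (T a) b = inner ℝ (T b) a) :
    ∃ K : ℝ, 0 < K ∧ ∀ p, inner ℝ (T p) p ≤ K * ‖T p‖ ^ 2 := by
  have : CompleteSpace H := FiniteDimensional.complete ℝ H
  have : CompleteSpace T.range := FiniteDimensional.complete ℝ _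
  -- The open mapping theorem replaces the smallest nonzero eigenvalue: p may be exchanged for a
  -- preimage x of `T p` with norm at most K‖Tp‖, and symmetry leaves the quadratic form unchanged.
  obtain ⟨K, hK, h⟩ := T.rangeRestrict.exists_preimage_norm_le
    (fun ⟨_, x, hx⟩ => ⟨x, Subtype.ext hx⟩)
  refine ⟨K, hK, fun p => ?_⟩
  obtain ⟨x, hx, hn⟩ := h (T.rangeRestrict p)
  have hTx : T x = T p := congrArg Subtype.val hx
  have h1 : inner ℝ (T p) p = inner ℝ (T p) x := by
    rw [hT p x, hTx]
  have hn' : ‖x‖ ≤ K * ‖T p‖ := hn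
  calc inner ℝ (T p) p = inner ℝ (T p) x := h1
    _ ≤ ‖T p‖ * ‖x‖ := real_inner_le_norm _ _
    _ ≤ ‖T p‖ * (K * ‖T p‖) := by gcongr
    _ = _ := by ring

/-- The energy identity behind the Lyapunov analysis. -/
theorem primal_dual_energy_identity (L U : H →L[ℝ] H)
    (hL : ∀ a b, inner ℝ (L a) b = inner ℝ (L b) a)
    (hU : ∀ a b, inner ℝ (U a) b = inner ℝ (U b) a) (c : ℝ) {xs : H} (hxs : L xs = 0)
    {x x' y y' p p' g e : H} (hp : p' = p + y')
    (hstep : g + e + c • U (x' - x) + c • L (y - x) - c • L (y' - x') + c • L p' = 0) :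
    inner ℝ (g + e) (x' - xs)
      + c / 2 * (inner ℝ (U (x' - xs)) (x' - xs) - inner ℝ (U (x - xs)) (x - xs)
        + inner ℝ (U (x' - x)) (x' - x))
      + c / 2 * (inner ℝ (L p') p' - inner ℝ (L p) p)
      + c / 2 * inner ℝ (L x') x' - c / 2 * inner ℝ (L (y' - x')) (y' - x')
      + c * inner ℝ (L (y - x)) x' - c * inner ℝ (L (x' + p)) (y' - x') = 0 := by
  have hxs' : ∀ z, inner ℝ (L z) xs = 0 := fun z => by rw [hL, hxs, inner_zero_left]
  have h0 : inner ℝ (g + e + c • U (x' - x) + c • L (y - x) - c • L (y' - x') + c • L p')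
      (x' - xs) = 0 := by rw [hstep, inner_zero_left]
  -- In terms of free increments from x*, the claim is a polynomial identity in inner products,
  -- modulo the symmetry of `L` and `U`.
  obtain ⟨q, rfl⟩ : ∃ q, y' = x' + q := ⟨y' - x', by abel⟩
  obtain ⟨a, rfl⟩ : ∃ a, x' = xs + a := ⟨x' - xs, by abel⟩
  obtain ⟨b, rfl⟩ : ∃ b, x = xs + b := ⟨x - xs, by abel⟩
  obtain ⟨r, rfl⟩ : ∃ r, y = xs + b + r := ⟨y - (xs + b), by abel⟩
  subst hp
  simp only [add_sub_cancel_left, add_sub_add_left_eq_sub, map_add, map_sub, inner_add_left,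
    inner_add_right, inner_sub_left, inner_sub_right, inner_smul_left, hxs, hxs', inner_zero_left,
    RCLike.conj_to_real] at h0 ⊢
  linear_combination h0 - c / 2 * hU a b - c / 2 * hL p a - c / 2 * hL p q - c / 2 * hL a q


/-- The Lyapunov function: a weighted sum of the primal error, the dual error and the error of the
estimates. -/
noncomputable def lyapunov (L U : H →L[ℝ] H) (c θ : ℝ) (xs x y p : H) : ℝ :=
  c / 2 * inner ℝ (U (x - xs)) (x - xs) + c / 2 * inner ℝ (L p) p + θ * ‖y - x‖ ^ 2

/-- The norm of the dual error is controlled by the other errors. -/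
theorem exists_sq_norm_dual_le (L U : H →L[ℝ] H) {c l : ℝ} (hc : 0 < c) (hl : 0 ≤ l) :
    ∃ N : ℝ, 0 < N ∧ ∀ xs x x' y y' p' g e : H,
      g + e + c • U (x' - x) + c • L (y - x) - c • L (y' - x') + c • L p' = 0 →
      ‖g‖ ≤ l * ‖x' - xs‖ → ‖e‖ ≤ 2 * l * ‖x' - x‖ →
      ‖L p'‖ ^ 2 ≤ N * (‖x' - xs‖ ^ 2 + ‖x' - x‖ ^ 2 + ‖y - x‖ ^ 2 + ‖y' - x'‖ ^ 2) := by
  set B := (l + 2 * l + c * ‖U‖ + c * ‖L‖ + 1) / c with hB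
  have hB0 : 0 < B := by positivity
  refine ⟨B ^ 2 * 4, by positivity, fun xs x x' y y' p' g e h hg he => ?_⟩
  have hU := U.le_opNorm (x' - x)
  have hL1 := L.le_opNorm (y - x)
  have hL2 := L.le_opNorm (y' - x')
  have heq : c • L p' = -(g + e + c • U (x' - x) + c • L (y - x) - c • L (y' - x')) := by
    rw [eq_neg_iff_add_eq_zero, add_comm]; exact h
  have h1 : c * ‖L p'‖ ≤ ‖g‖ + ‖e‖ + c * ‖U (x' - x)‖ + c * ‖L (y - x)‖ + c * ‖L (y' - x')‖ := by
    calc c * ‖L p'‖ = ‖c • L p'‖ := by rw [norm_smul, Real.norm_of_nonneg hc.le]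
      _ ≤ ‖g‖ + ‖e‖ + ‖c • U (x' - x)‖ + ‖c • L (y - x)‖ + ‖c • L (y' - x')‖ := by
        rw [heq, norm_neg]
        refine (norm_sub_le _ _).trans ?_
        gcongr
        exact norm_add₄_le
      _ = _ := by simp only [norm_smul, Real.norm_of_nonneg hc.le]
  have hcB : c * B = l + 2 * l + c * ‖U‖ + c * ‖L‖ + 1 := by rw [hB]; field_simp
  have h2 : ‖L p'‖ ≤ B * (‖x' - xs‖ + ‖x' - x‖ + ‖y - x‖ + ‖y' - x'‖) := by
    refine le_of_mul_le_mul_left ?_ hc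
    rw [← mul_assoc, hcB]
    have e1 := mul_le_mul_of_nonneg_left hU hc.le
    have e2 := mul_le_mul_of_nonneg_left hL1 hc.le
    have e3 := mul_le_mul_of_nonneg_left hL2 hc.le
    have n1 := norm_nonneg (x' - xs)
    have n2 := norm_nonneg (x' - x)
    have n3 := norm_nonneg (y - x)
    have n4 := norm_nonneg (y' - x')
    have n5 : 0 ≤ c * ‖U‖ := by positivity
    have n6 : 0 ≤ c * ‖L‖ := by positivity
    nlinarith [mul_nonneg hl n1, mul_nonneg hl n2, mul_nonneg hl n3, mul_nonneg hl n4,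
      mul_nonneg n5 n1, mul_nonneg n5 n3, mul_nonneg n5 n4,
      mul_nonneg n6 n1, mul_nonneg n6 n2]
  calc ‖L p'‖ ^ 2 ≤ (B * (‖x' - xs‖ + ‖x' - x‖ + ‖y - x‖ + ‖y' - x'‖)) ^ 2 := by gcongr
    _ = B ^ 2 * (‖x' - xs‖ + ‖x' - x‖ + ‖y - x‖ + ‖y' - x'‖) ^ 2 := by ring
    _ ≤ B ^ 2 * (4 * (‖x' - xs‖ ^ 2 + ‖x' - x‖ ^ 2 + ‖y - x‖ ^ 2 + ‖y' - x'‖ ^ 2)) := by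
      gcongr; exact sq_add_four_le _ _ _ _
    _ = _ := by ring

/-- The Lyapunov function is controlled by the errors that decrease in a step. -/
theorem exists_lyapunov_le [FiniteDimensional ℝ H] (L U : H →L[ℝ] H)
    (hL : ∀ a b, inner ℝ (L a) b = inner ℝ (L b) a) {c l θ : ℝ} (hc : 0 < c) (hl : 0 ≤ l)
    (hθ : 0 ≤ θ) :
    ∃ M : ℝ, 0 < M ∧ ∀ xs x x' y y' p' g e : H,
      g + e + c • U (x' - x) + c • L (y - x) - c • L (y' - x') + c • L p' = 0 →
      ‖g‖ ≤ l * ‖x' - xs‖ → ‖e‖ ≤ 2 * l * ‖x' - x‖ →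
      lyapunov L U c θ xs x' y' p'
        ≤ M * (‖x' - xs‖ ^ 2 + ‖x' - x‖ ^ 2 + ‖y - x‖ ^ 2 + ‖y' - x'‖ ^ 2) := by
  obtain ⟨K, hK, hKL⟩ := exists_inner_le_sq_norm_image L hL
  obtain ⟨N, hN, hdual⟩ := exists_sq_norm_dual_le L U hc hl
  refine ⟨c / 2 * ‖U‖ + c / 2 * (K * N) + θ, by positivity,
    fun xs x x' y y' p' g e hstep hg2 he => ?_⟩
  set T := ‖x' - xs‖ ^ 2 + ‖x' - x‖ ^ 2 + ‖y - x‖ ^ 2 + ‖y' - x'‖ ^ 2 with hT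
  have h1 : inner ℝ (U (x' - xs)) (x' - xs) ≤ ‖U‖ * T := by
    calc inner ℝ (U (x' - xs)) (x' - xs) ≤ ‖U (x' - xs)‖ * ‖x' - xs‖ := real_inner_le_norm _ _
      _ ≤ (‖U‖ * ‖x' - xs‖) * ‖x' - xs‖ := by gcongr; exact U.le_opNorm _
      _ = ‖U‖ * ‖x' - xs‖ ^ 2 := by ring
      _ ≤ _ := by
        gcongr; rw [hT]
        linarith [sq_nonneg ‖x' - x‖, sq_nonneg ‖y - x‖, sq_nonneg ‖y' - x'‖]
  -- Nothing controls p' itself, whose component in the kernel of `L` is free; only `L p'` can be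
  -- read off from the step equation.
  have h2 : inner ℝ (L p') p' ≤ K * N * T :=
    (hKL p').trans ((mul_le_mul_of_nonneg_left
      (hdual xs x x' y y' p' g e hstep hg2 he) hK.le).trans_eq (mul_assoc _ _ _).symm)
  have h3 : ‖y' - x'‖ ^ 2 ≤ T := by
    rw [hT]; linarith [sq_nonneg ‖x' - x‖, sq_nonneg ‖y - x‖, sq_nonneg ‖x' - xs‖]
  have e1 := mul_le_mul_of_nonneg_left h1 (by positivity : 0 ≤ c / 2)
  have e2 := mul_le_mul_of_nonneg_left h2 (by positivity : 0 ≤ c / 2)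
  have e3 := mul_le_mul_of_nonneg_left h3 hθ
  rw [lyapunov]
  linarith

/-- One step of the algorithm contracts the Lyapunov function, up to two terms whose expectations
are nonpositive and zero respectively. -/
theorem exists_lyapunov_contraction [FiniteDimensional ℝ H] (L U : H →L[ℝ] H)
    (hL : ∀ a b, inner ℝ (L a) b = inner ℝ (L b) a)
    (hU : ∀ a b, inner ℝ (U a) b = inner ℝ (U b) a) {lam mu c v l s : ℝ}
    (hL0 : ∀ z, 0 ≤ inner ℝ (L z) z) (hLlam : ∀ z, inner ℝ (L z) z ≤ lam * ‖z‖ ^ 2)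
    (hUmu : ∀ z, mu * ‖z‖ ^ 2 ≤ inner ℝ (U z) z)
    (hlam : 0 < lam) (hc : 0 < c) (hv : 0 < v) (hl : 0 ≤ l) (hs0 : 0 ≤ s) (hs1 : s < 1)
    (hcond : l ^ 2 < v * (c / 2 * (mu - 3 * lam * (s ^ 2 / (1 - s) ^ 2)))) :
    ∃ θ ρ b : ℝ, 0 ≤ θ ∧ 0 < ρ ∧ 0 ≤ b ∧ ∀ xs x x' y y' p p' g e : H, L xs = 0 → p' = p + y' →
      g + e + c • U (x' - x) + c • L (y - x) - c • L (y' - x') + c • L p' = 0 →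
      v * ‖x' - xs‖ ^ 2 ≤ inner ℝ g (x' - xs) → ‖g‖ ≤ l * ‖x' - xs‖ → ‖e‖ ≤ 2 * l * ‖x' - x‖ →
      (1 + ρ) * lyapunov L U c θ xs x' y' p' ≤ lyapunov L U c θ xs x y p
        + b * (‖y' - x'‖ ^ 2 - s ^ 2 * ‖x' - y‖ ^ 2)
        + c * inner ℝ (L (x' + p)) (y' - x') := by
  have h1s : 0 < 1 - s := by linarith
  obtain ⟨κ₀, hκ₀, hquad⟩ := exists_pos_quadratic_lower_bound hv hcond
  -- The solution of (cλ/2 + θ)s = θ - cλ: the part of the new compression error that is charged to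
  -- ‖y - x‖² falls short of θ by cλ. Of this, cλ/2 pays for the cross term and cλ/2 remains as
  -- decrease.
  set θ := c / 2 * lam * (2 + s) / (1 - s) with hθ
  have hθ0 : 0 ≤ θ := by positivity
  set κ := min κ₀ (c / 2 * lam) with hκ
  have hκ0 : 0 < κ := lt_min hκ₀ (by positivity)
  obtain ⟨M, hM0, hup⟩ := exists_lyapunov_le L U hL hc hl hθ0
  -- V' is at most M times a sum that includes ‖y' - x'‖², which need not decrease. Exchanging it
  -- for s²‖x' - y‖², at most 2(‖x' - x‖² + ‖y - x‖²), costs the factor 3 in the rate and the extra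
  -- κ/3 in b.
  refine ⟨θ, κ / (3 * M), c / 2 * lam + θ + κ / 3, hθ0, by positivity, by positivity, ?_⟩
  intro xs x x' y y' p p' g e hxs hp hstep hg1 hg2 he
  have hid := primal_dual_energy_identity L U hL hU c hxs hp hstep
  -- Nonnegativity of the `L`-form at x' + (y - x); the energy balance contains exactly the
  -- (c/2)⟨Lx', x'⟩ needed to pay for it.
  have hcross : -(inner ℝ (L x') x' + inner ℝ (L (y - x)) (y - x)) ≤ 2 * inner ℝ (L (y - x)) x' := by
    have := hL0 (x' + (y - x))
    rw [map_add, inner_add_left, inner_add_right, inner_add_right, hL x' (y - x)] at this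
    linarith
  have hinner : v * ‖x' - xs‖ ^ 2 - 2 * l * (‖x' - xs‖ * ‖x' - x‖)
      ≤ inner ℝ (g + e) (x' - xs) := by
    rw [inner_add_left]
    have h1 := neg_le_of_abs_le (abs_real_inner_le_norm e (x' - xs))
    have h2 := mul_le_mul_of_nonneg_right he (norm_nonneg (x' - xs))
    linarith
  have hcU := mul_le_mul_of_nonneg_left (hUmu (x' - x)) (by positivity : 0 ≤ c / 2)
  have hcr := mul_le_mul_of_nonneg_left hcross (by positivity : 0 ≤ c / 2)
  have hl1 := mul_le_mul_of_nonneg_left (hLlam (y - x)) (by positivity : 0 ≤ c / 2)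
  have hl2 := mul_le_mul_of_nonneg_left (hLlam (y' - x')) (by positivity : 0 ≤ c / 2)
  have hq := hquad ‖x' - xs‖ ‖x' - x‖
  have hxy : x' - y = (x' - x) - (y - x) := by abel
  have hcomp := mul_le_mul_of_nonneg_left (mul_sq_norm_sub_le hs0 hs1 (x' - x) (y - x))
    (by positivity : 0 ≤ c / 2 * lam + θ)
  rw [← hxy] at hcomp
  have hcoef1 : (c / 2 * lam + θ) * s = θ - c * lam := by rw [hθ]; field_simp; ring
  have hcoef2 : (c / 2 * lam + θ) * (s ^ 2 / (1 - s)) = c / 2 * (3 * lam * (s ^ 2 / (1 - s) ^ 2)) := by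
    rw [hθ]; field_simp; ring
  have hcomp' : (c / 2 * lam + θ) * (s ^ 2 * ‖x' - y‖ ^ 2) ≤ (θ - c * lam) * ‖y - x‖ ^ 2
      + c / 2 * (3 * lam * (s ^ 2 / (1 - s) ^ 2)) * ‖x' - x‖ ^ 2 := by
    rw [← hcoef1, ← hcoef2]; linarith
  set X := ‖x' - xs‖ ^ 2 with hX
  set D := ‖x' - x‖ ^ 2 with hD
  set E := ‖y - x‖ ^ 2 with hE
  set E' := ‖y' - x'‖ ^ 2 with hE'
  have hX0 : 0 ≤ X := sq_nonneg _
  have hD0 : 0 ≤ D := sq_nonneg _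
  have hE0 : 0 ≤ E := sq_nonneg _
  have hE'0 : 0 ≤ E' := sq_nonneg _
  have hk1 : κ * (X + D) ≤ κ₀ * (X + D) := by gcongr; exact min_le_left _ _
  have hk2 : κ * E ≤ c / 2 * lam * E := by gcongr; exact min_le_right _ _
  have hdecr : lyapunov L U c θ xs x' y' p' ≤ lyapunov L U c θ xs x y p - κ * (X + D + E)
      + (c / 2 * lam + θ) * (E' - s ^ 2 * ‖x' - y‖ ^ 2)
      + c * inner ℝ (L (x' + p)) (y' - x') := by
    unfold lyapunov
    linarith only [hid, hinner, hcU, hcr, hl1, hl2, hq, hcomp', hk1, hk2]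
  have hupper := hup xs x x' y y' p' g e hstep hg2 he
  have hxy2 : s ^ 2 * ‖x' - y‖ ^ 2 ≤ 2 * (D + E) := by
    have h2 : ‖x' - y‖ ≤ ‖x' - x‖ + ‖y - x‖ := by rw [hxy]; exact norm_sub_le _ _
    calc s ^ 2 * ‖x' - y‖ ^ 2 ≤ 1 * ‖x' - y‖ ^ 2 := by
          gcongr; exact pow_le_one₀ hs0 hs1.le
      _ ≤ (‖x' - x‖ + ‖y - x‖) ^ 2 := by rw [one_mul]; gcongr
      _ ≤ 2 * (D + E) := add_sq_le
  have hρ : κ / (3 * M) * lyapunov L U c θ xs x' y' p' ≤ κ / 3 * (X + D + E + E') := by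
    calc _ ≤ κ / (3 * M) * (M * (X + D + E + E')) := by gcongr
      _ = _ := by field_simp
  have hfin : κ / 3 * (X + D + E + E') ≤ κ * (X + D + E)
      + κ / 3 * (E' - s ^ 2 * ‖x' - y‖ ^ 2) := by
    have := mul_le_mul_of_nonneg_left hxy2 (by positivity : 0 ≤ κ / 3)
    have h2 := mul_nonneg hκ0.le hX0
    linarith only [this, h2]
  linarith only [hdecr, hρ, hfin]

end InnerProduct

/-! ### Rayleigh quotient bounds by expansion in an orthonormal eigenbasis. -/

theorem Matrix.IsHermitian.dotProduct_mulVec_eq_sum {n : ℕ} {M : Matrix (Fin n) (Fin n) ℝ}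
    (hM : M.IsHermitian) (x : Fin n → ℝ) :
    x ⬝ᵥ M.mulVec x
      = ∑ i, hM.eigenvalues i * (inner ℝ (hM.eigenvectorBasis i) (WithLp.toLp 2 x)) ^ 2 := by
  have h := hM.eigenvectorBasis.sum_inner_mul_inner (WithLp.toLp 2 x) (WithLp.toLp 2 (M.mulVec x))
  have h1 : inner ℝ (WithLp.toLp 2 x) (WithLp.toLp 2 (M.mulVec x)) = x ⬝ᵥ M.mulVec x := by
    simp [EuclideanSpace.inner_toLp_toLp, dotProduct_comm]
  rw [← h1, ← h]
  refine Finset.sum_congr rfl fun i _ => ?_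
  have h2 : inner ℝ (hM.eigenvectorBasis i) (WithLp.toLp 2 (M.mulVec x))
      = hM.eigenvalues i * inner ℝ (hM.eigenvectorBasis i) (WithLp.toLp 2 x) := by
    have h3 := hM.mulVec_eigenvectorBasis i
    have h4 : M.transpose = M := by
      rw [← Matrix.conjTranspose_eq_transpose_of_trivial]; exact hM
    simp only [EuclideanSpace.inner_eq_star_dotProduct, star_trivial]
    rw [dotProduct_comm, Matrix.dotProduct_mulVec, ← Matrix.mulVec_transpose, h4, h3,
      smul_dotProduct, dotProduct_comm, smul_eq_mul]
  rw [h2, real_inner_comm]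
  ring

theorem Matrix.IsHermitian.sum_sq_inner_eigenvectorBasis {n : ℕ} {M : Matrix (Fin n) (Fin n) ℝ}
    (hM : M.IsHermitian) (x : Fin n → ℝ) :
    ∑ i, (inner ℝ (hM.eigenvectorBasis i) (WithLp.toLp 2 x)) ^ 2 = ∑ i, x i ^ 2 := by
  have h := hM.eigenvectorBasis.sum_sq_norm_inner_right (WithLp.toLp 2 x)
  simp only [Real.norm_eq_abs, sq_abs] at h
  rw [h, EuclideanSpace.real_norm_sq_eq]

theorem Matrix.IsHermitian.dotProduct_mulVec_le {n : ℕ} {M : Matrix (Fin n) (Fin n) ℝ}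
    (hM : M.IsHermitian) (x : Fin n → ℝ) :
    x ⬝ᵥ M.mulVec x ≤ (⨆ i, hM.eigenvalues i) * ∑ i, x i ^ 2 := by
  rw [hM.dotProduct_mulVec_eq_sum, ← hM.sum_sq_inner_eigenvectorBasis, Finset.mul_sum]
  gcongr with i
  exact le_ciSup (Set.finite_range _).bddAbove i

theorem Matrix.IsHermitian.le_dotProduct_mulVec {n : ℕ} {M : Matrix (Fin n) (Fin n) ℝ}
    (hM : M.IsHermitian) (x : Fin n → ℝ) :
    (⨅ i, hM.eigenvalues i) * ∑ i, x i ^ 2 ≤ x ⬝ᵥ M.mulVec x := by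
  rw [hM.dotProduct_mulVec_eq_sum, ← hM.sum_sq_inner_eigenvectorBasis, Finset.mul_sum]
  gcongr with i
  exact ciInf_le (Set.finite_range _).bddBelow i

/-! ### Matrices acting on stacked vectors, and the Laplacian of a connected graph. -/

namespace CCDQM

/-- The stacked space `(ℝ^d)^n`. -/
abbrev Stack (n d : ℕ) : Type := PiLp 2 (fun _ : Fin n => Vec d)

instance (n d : ℕ) : ContinuousSMul ℝ (Stack n d) := IsBoundedSMul.continuousSMul

/-- The linear map `M ⊗ I` on the stacked space. -/
noncomputable def matLin {n d : ℕ} (M : Matrix (Fin n) (Fin n) ℝ) : Stack n d →ₗ[ℝ] Stack n d where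
  toFun z := WithLp.toLp 2 fun i => ∑ j, M i j • z j
  map_add' a b := by
    ext1 i
    simp only [PiLp.add_apply, smul_add, Finset.sum_add_distrib]
  map_smul' r a := by
    ext1 i
    simp only [PiLp.smul_apply, Finset.smul_sum, smul_comm r, RingHom.id_apply]

/-- The operator `M ⊗ I` on the stacked space, as a continuous map. -/
noncomputable def matOp {n d : ℕ} (M : Matrix (Fin n) (Fin n) ℝ) : Stack n d →L[ℝ] Stack n d :=
  ⟨matLin M, (matLin M).continuous_of_finiteDimensional⟩

variable {n d : ℕ}

theorem matOp_apply (M : Matrix (Fin n) (Fin n) ℝ) (z : Stack n d) (i : Fin n) :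
    matOp M z i = ∑ j, M i j • z j := rfl

theorem inner_matOp_comm {M : Matrix (Fin n) (Fin n) ℝ} (hM : M.IsHermitian) (a b : Stack n d) :
    inner ℝ (matOp M a) b = inner ℝ (matOp M b) a := by
  rw [PiLp.inner_apply, PiLp.inner_apply]
  simp only [matOp_apply, sum_inner, inner_smul_left, RCLike.conj_to_real]
  rw [Finset.sum_comm]
  refine Finset.sum_congr rfl fun i _ => Finset.sum_congr rfl fun j _ => ?_
  have : M j i = M i j := by simpa using hM.apply i j
  rw [this, real_inner_comm]

theorem matOp_apply_apply (M : Matrix (Fin n) (Fin n) ℝ) (z : Stack n d) (i : Fin n) (a : Fin d) :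
    matOp M z i a = M.mulVec (fun j => z j a) i := by
  simp [matOp_apply, Matrix.mulVec, dotProduct]

/-- The form splits into d copies of the form of `M`, one per coordinate of ℝ^d, so eigenvalue
bounds carry over with the same constants. -/
theorem inner_matOp_self (M : Matrix (Fin n) (Fin n) ℝ) (z : Stack n d) :
    inner ℝ (matOp M z) z = ∑ a, (fun i => z i a) ⬝ᵥ M.mulVec (fun i => z i a) := by
  simp only [PiLp.inner_apply, matOp_apply_apply, dotProduct]
  rw [Finset.sum_comm]
  simp

theorem norm_sq_eq_sum_sum (z : Stack n d) : ‖z‖ ^ 2 = ∑ a, ∑ i, z i a ^ 2 := by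
  rw [PiLp.norm_sq_eq_of_L2, Finset.sum_comm]
  simp [EuclideanSpace.real_norm_sq_eq]

theorem inner_matOp_self_le {M : Matrix (Fin n) (Fin n) ℝ} (hM : M.IsHermitian) (z : Stack n d) :
    inner ℝ (matOp M z) z ≤ (⨆ i, hM.eigenvalues i) * ‖z‖ ^ 2 := by
  rw [inner_matOp_self, norm_sq_eq_sum_sum, Finset.mul_sum]
  exact Finset.sum_le_sum fun a _ => hM.dotProduct_mulVec_le _

theorem le_inner_matOp_self {M : Matrix (Fin n) (Fin n) ℝ} (hM : M.IsHermitian) (z : Stack n d) :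
    (⨅ i, hM.eigenvalues i) * ‖z‖ ^ 2 ≤ inner ℝ (matOp M z) z := by
  rw [inner_matOp_self, norm_sq_eq_sum_sum, Finset.mul_sum]
  exact Finset.sum_le_sum fun a _ => hM.le_dotProduct_mulVec _

section Graph

variable (G : SimpleGraph (Fin n)) [DecidableRel G.Adj]

theorem inner_matOp_lap_nonneg (z : Stack n d) : 0 ≤ inner ℝ (matOp (G.lapMatrix ℝ) z) z := by
  rw [inner_matOp_self]
  refine Finset.sum_nonneg fun a _ => ?_
  simpa using (SimpleGraph.posSemidef_lapMatrix ℝ G).dotProduct_mulVec_nonneg (fun i => z i a)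

theorem matOp_lap_apply (z : Stack n d) (i : Fin n) :
    matOp (G.lapMatrix ℝ) z i = ∑ j ∈ G.neighborFinset i, (z i - z j) := by
  ext a
  rw [matOp_apply_apply, SimpleGraph.lapMatrix_mulVec_apply]
  simp [Finset.sum_sub_distrib]

/-- This converts the regularizer 2c d_i I of the primal update into the two Laplacians of the
energy balance. -/
theorem matOp_lap_add_unsignedLap_apply (z : Stack n d) (i : Fin n) :
    matOp (G.lapMatrix ℝ) z i + matOp (unsignedLap G) z i = (2 * (G.degree i : ℝ)) • z i := by
  ext a
  rw [PiLp.add_apply, matOp_apply_apply, matOp_apply_apply, ← Pi.add_apply, ← Matrix.add_mulVec]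
  have : G.lapMatrix ℝ + unsignedLap G = (2 : ℝ) • G.degMatrix ℝ := by
    rw [SimpleGraph.lapMatrix, unsignedLap, two_smul]; abel
  rw [this, Matrix.smul_mulVec, Pi.smul_apply, SimpleGraph.degMatrix_mulVec_apply]
  simp [mul_assoc]

variable {G}

theorem matOp_lap_const (x : Vec d) :
    matOp (G.lapMatrix ℝ) (WithLp.toLp 2 fun _ => x : Stack n d) = 0 := by
  ext i a
  rw [matOp_lap_apply]
  simp

theorem eq_of_matOp_lap_eq_zero (hG : G.Connected) {z : Stack n d}
    (hz : matOp (G.lapMatrix ℝ) z = 0) (i j : Fin n) : z i = z j := by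
  ext a
  have h : (G.lapMatrix ℝ).mulVec (fun k => z k a) = 0 := by
    ext k
    rw [← matOp_apply_apply, hz]; rfl
  exact (SimpleGraph.lapMatrix_mulVec_eq_zero_iff_forall_reachable G).1 h i j (hG.preconnected i j)

/-- On a connected graph, the range of the Laplacian is the orthogonal complement of consensus. -/
theorem exists_matOp_lap_eq (hG : G.Connected) {g : Stack n d} (hg : ∑ i, g i = 0) :
    ∃ p : Stack n d, matOp (G.lapMatrix ℝ) p = g := by
  have hmem : g ∈ (matOp (d := d) (G.lapMatrix ℝ)).range := by
    -- By symmetry a vector orthogonal to the range is in the kernel, hence constant over the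
    -- agents, and its pairing with g is a pairing with the sum of the g_i.
    rw [← Submodule.orthogonal_orthogonal (matOp (d := d) (G.lapMatrix ℝ)).range,
      Submodule.mem_orthogonal]
    intro u hu
    rw [Submodule.mem_orthogonal] at hu
    have h0 : matOp (G.lapMatrix ℝ) u = 0 := by
      rw [← inner_self_eq_zero (𝕜 := ℝ), inner_matOp_comm (lap_isHermitian G)]
      exact hu _ ⟨_, rfl⟩
    obtain ⟨i₀⟩ := hG.nonempty
    rw [PiLp.inner_apply]
    calc ∑ i, inner ℝ (u i) (g i) = ∑ i, inner ℝ (u i₀) (g i) :=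
          Finset.sum_congr rfl fun i _ => by rw [eq_of_matOp_lap_eq_zero hG h0 i i₀]
      _ = 0 := by rw [← inner_sum, hg, inner_zero_right]
  exact hmem

theorem lapEigMax_nonneg : 0 ≤ lapEigMax G :=
  Real.iSup_nonneg fun i => (SimpleGraph.posSemidef_lapMatrix ℝ G).eigenvalues_nonneg i

end Graph

end CCDQM

/-! ### Strong convexity: Hessian bounds, the regularized inverse, existence and uniqueness of the
minimizer. -/

namespace CCDQM
variable {d : ℕ}

open Filter Topology in
/-- The derivative of a strongly monotone map is coercive. -/
theorem _root_.HasFDerivAt.coercive_of_strongly_monotone {H : Type*} [NormedAddCommGroup H]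
    [InnerProductSpace ℝ H] {F : H → H} {A : H →L[ℝ] H} {y : H} {v : ℝ} (hF : HasFDerivAt F A y)
    (hv : ∀ x x' : H, v * ‖x' - x‖ ^ 2 ≤ inner ℝ (F x' - F x) (x' - x)) (u : H) :
    v * ‖u‖ ^ 2 ≤ inner ℝ (A u) u := by
  -- Along the line through y in direction u, monotonicity divided by t² bounds the difference
  -- quotients from below; the bound passes to the limit.
  have h1 : HasDerivAt (fun t : ℝ => F (y + t • u)) (A u) 0 := by
    have h2 : HasDerivAt (fun t : ℝ => y + t • u) u 0 := by
      simpa using ((hasDerivAt_id (0 : ℝ)).smul_const u).const_add y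
    have h3 : HasFDerivAt F A (y + (0 : ℝ) • u) := by simpa using hF
    exact h3.comp_hasDerivAt 0 h2
  have h4 := hasDerivAt_iff_tendsto_slope.1 h1
  have h5 : Tendsto (fun t => inner ℝ (slope (fun t : ℝ => F (y + t • u)) 0 t) u) (𝓝[≠] 0)
      (𝓝 (inner ℝ (A u) u)) := h4.inner tendsto_const_nhds
  refine ge_of_tendsto h5 ?_
  filter_upwards [self_mem_nhdsWithin] with t ht
  have ht : t ≠ 0 := ht
  have h6 := hv y (y + t • u)
  rw [add_sub_cancel_left, norm_smul, inner_smul_right, mul_pow, Real.norm_eq_abs, sq_abs] at h6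
  have h7 : 0 < t ^ 2 := by positivity
  rw [slope_def_module, sub_zero, zero_smul, add_zero, inner_smul_left, RCLike.conj_to_real]
  refine le_of_mul_le_mul_left ?_ h7
  calc t ^ 2 * (v * ‖u‖ ^ 2) = v * (t ^ 2 * ‖u‖ ^ 2) := by ring
    _ ≤ _ := h6
    _ = _ := by field_simp

/-- A function with strongly monotone gradient lies above its quadratic lower models. -/
theorem quadratic_lower_model {f : Vec d → ℝ} {v : ℝ} (hd : Differentiable ℝ f)
    (hv : ∀ x x' : Vec d, v * ‖x' - x‖ ^ 2 ≤ inner ℝ (gradient f x' - gradient f x) (x' - x))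
    (x u : Vec d) : f x + inner ℝ (gradient f x) u + v / 2 * ‖u‖ ^ 2 ≤ f (x + u) := by
  -- Along the segment, f minus its quadratic model has derivative at least zero by strong
  -- monotonicity, so it is nondecreasing on [0, 1].
  have hder : ∀ t : ℝ, HasDerivAt
      (fun t : ℝ => f (x + t • u) - t * inner ℝ (gradient f x) u - t ^ 2 * (v / 2 * ‖u‖ ^ 2))
      (inner ℝ (gradient f (x + t • u)) u - inner ℝ (gradient f x) u - 2 * t * (v / 2 * ‖u‖ ^ 2))
      t := by
    intro t
    have h2 : HasDerivAt (fun t : ℝ => x + t • u) u t := by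
      simpa using ((hasDerivAt_id t).smul_const u).const_add x
    have h3 : HasFDerivAt f (fderiv ℝ f (x + t • u)) (x + t • u) := (hd _).hasFDerivAt
    have h4 := h3.comp_hasDerivAt t h2
    rw [← inner_gradient_left] at h4
    have h5 := (hasDerivAt_id t).mul_const (inner ℝ (gradient f x) u)
    have h6 := ((hasDerivAt_id t).pow 2).mul_const (v / 2 * ‖u‖ ^ 2)
    exact ((h4.sub h5).sub h6).congr_deriv (by simp)
  have hmono := monotoneOn_of_deriv_nonneg (convex_Icc (0 : ℝ) 1)
    (fun t _ => (hder t).continuousAt.continuousWithinAt)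
    (fun t _ => (hder t).differentiableAt.differentiableWithinAt) (fun t ht => by
      rw [interior_Icc] at ht
      rw [(hder t).deriv]
      have h := hv x (x + t • u)
      rw [add_sub_cancel_left, norm_smul, inner_smul_right, mul_pow, Real.norm_eq_abs, sq_abs,
        inner_sub_left] at h
      have ht0 : 0 < t := ht.1
      have h7 : v * t * ‖u‖ ^ 2 ≤ inner ℝ (gradient f (x + t • u)) u - inner ℝ (gradient f x) u := by
        refine le_of_mul_le_mul_left ?_ ht0
        linarith
      linarith)
  have h := hmono (Set.left_mem_Icc.2 zero_le_one) (Set.right_mem_Icc.2 zero_le_one) zero_le_one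
  simp only [zero_smul, one_smul, add_zero] at h
  linarith

open Filter in
/-- A differentiable function with strongly monotone gradient has a minimizer. -/
theorem exists_minimizer {f : Vec d → ℝ} {v : ℝ} (hv0 : 0 < v) (hd : Differentiable ℝ f)
    (hv : ∀ x x' : Vec d, v * ‖x' - x‖ ^ 2 ≤ inner ℝ (gradient f x' - gradient f x) (x' - x)) :
    ∃ z, ∀ x, f z ≤ f x := by
  refine hd.continuous.exists_forall_le ?_
  have h1 : ∀ x : Vec d, f 0 + ‖x‖ * (v / 2 * ‖x‖ - ‖gradient f 0‖) ≤ f x := fun x => by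
    have h := quadratic_lower_model hd hv 0 x
    rw [zero_add] at h
    have h2 := neg_le_of_abs_le (abs_real_inner_le_norm (gradient f 0) x)
    linarith
  refine tendsto_atTop_mono h1 (tendsto_atTop_add_const_left _ _ ?_)
  have hn := tendsto_norm_cocompact_atTop (E := Vec d)
  refine hn.atTop_mul_atTop₀ ?_
  exact tendsto_atTop_add_const_right _ _ (hn.const_mul_atTop (by positivity))

namespace StronglyConvexSmooth

variable {f : Vec d → ℝ} {v l : ℝ}

theorem hasFDerivAt_gradient (hf : StronglyConvexSmooth f v l) (y : Vec d) :
    HasFDerivAt (gradient f) (hessian f y) y := (hf.differentiable_gradient y).hasFDerivAt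

theorem hessian_coercive (hf : StronglyConvexSmooth f v l) (y u : Vec d) :
    v * ‖u‖ ^ 2 ≤ inner ℝ (hessian f y u) u :=
  (hf.hasFDerivAt_gradient y).coercive_of_strongly_monotone hf.strong u

theorem norm_hessian_apply_le (hf : StronglyConvexSmooth f v l) {B : ℝ} (hB : 0 ≤ B) (hlB : l ≤ B)
    (y u : Vec d) : ‖hessian f y u‖ ≤ B * ‖u‖ := by
  have h : ‖hessian f y‖ ≤ B := norm_fderiv_le_of_lip' ℝ hB (Filter.Eventually.of_forall fun x =>
    (hf.lipschitz y x).trans (by gcongr))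
  exact (ContinuousLinearMap.le_opNorm _ _).trans (by gcongr)

/-- The regularized Hessian is bounded below by the modulus of strong convexity. -/
theorem regularized_coercive (hf : StronglyConvexSmooth f v l) {a : ℝ} (ha : 0 ≤ a) (y u : Vec d) :
    v * ‖u‖ ≤ ‖(a • ContinuousLinearMap.id ℝ (Vec d) + hessian f y) u‖ := by
  rcases eq_or_ne u 0 with rfl | hu
  · simp
  have h1 : v * ‖u‖ ^ 2 ≤ inner ℝ ((a • ContinuousLinearMap.id ℝ (Vec d) + hessian f y) u) u := by
    have h2 := hf.hessian_coercive y u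
    have h3 : 0 ≤ a * ‖u‖ ^ 2 := by positivity
    simp only [add_apply, smul_apply,
      ContinuousLinearMap.id_apply, inner_add_left, inner_smul_left, RCLike.conj_to_real,
      real_inner_self_eq_norm_sq]
    linarith
  have h4 := h1.trans (real_inner_le_norm _ _)
  have hu' : 0 < ‖u‖ := norm_pos_iff.2 hu
  refine le_of_mul_le_mul_right ?_ hu'
  linarith

theorem isInvertible_regularized (hf : StronglyConvexSmooth f v l) {a : ℝ} (ha : 0 ≤ a)
    (y : Vec d) : (a • ContinuousLinearMap.id ℝ (Vec d) + hessian f y).IsInvertible := by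
  set A := a • ContinuousLinearMap.id ℝ (Vec d) + hessian f y with hA
  have hinj : Function.Injective (A : Vec d →ₗ[ℝ] Vec d) := by
    rw [injective_iff_map_eq_zero]
    intro u hu
    have h := hf.regularized_coercive ha y u
    rw [← hA, show A u = 0 from hu, norm_zero] at h
    have : ‖u‖ ≤ 0 := by
      refine le_of_mul_le_mul_left ?_ hf.modulus_pos
      linarith
    exact norm_le_zero_iff.1 this
  exact ⟨(LinearEquiv.ofInjectiveEndo _ hinj).toContinuousLinearEquiv, by ext x; rfl⟩

theorem norm_inverse_regularized_le (hf : StronglyConvexSmooth f v l) {a : ℝ} (ha : 0 ≤ a)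
    (y g : Vec d) :
    ‖(a • ContinuousLinearMap.id ℝ (Vec d) + hessian f y).inverse g‖ ≤ v⁻¹ * ‖g‖ := by
  have h := hf.regularized_coercive ha y
    ((a • ContinuousLinearMap.id ℝ (Vec d) + hessian f y).inverse g)
  rw [(hf.isInvertible_regularized ha y).self_apply_inverse] at h
  rw [← div_eq_inv_mul, le_div_iff₀ hf.modulus_pos]
  linarith

/-- The Hessian need not be continuous, but as a derivative it is measurable. Inversion is
continuous on the units, where all regularized Hessians lie, so the composition is taken through
that subtype. -/
theorem measurable_inverse_regularized_apply (hf : StronglyConvexSmooth f v l) {a : ℝ}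
    (ha : 0 ≤ a) : Measurable fun q : Vec d × Vec d =>
      (a • ContinuousLinearMap.id ℝ (Vec d) + hessian f q.1).inverse q.2 := by
  set O : Set (Vec d →L[ℝ] Vec d) := {A | IsUnit A} with hO
  have hmem : ∀ y, a • ContinuousLinearMap.id ℝ (Vec d) + hessian f y ∈ O := fun y => by
    obtain ⟨e, he⟩ := hf.isInvertible_regularized ha y
    rw [hO, Set.mem_ofPred_eq, ← he]
    exact (ContinuousLinearEquiv.unitsEquiv ℝ (Vec d)).symm e |>.isUnit
  have hcont : Continuous fun A : O => (A : Vec d →L[ℝ] Vec d).inverse := by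
    rw [← ContinuousLinearMap.ringInverse_eq_inverse]
    refine continuous_iff_continuousAt.2 fun A => ?_
    obtain ⟨w, hw⟩ := A.2
    have h := NormedRing.inverse_continuousAt w
    rw [hw] at h
    exact h.comp continuous_subtype_val.continuousAt
  have hev : Continuous fun q : O × Vec d => (q.1 : Vec d →L[ℝ] Vec d).inverse q.2 :=
    (hcont.comp continuous_fst).clm_apply continuous_snd
  have hH : Measurable fun y : Vec d =>
      (⟨a • ContinuousLinearMap.id ℝ (Vec d) + hessian f y, hmem y⟩ : O) :=
    ((measurable_fderiv ℝ (gradient f)).const_add _).subtype_mk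
  exact hev.measurable.comp ((hH.comp measurable_fst).prodMk measurable_snd)

end StronglyConvexSmooth

/-- Sums of strongly convex functions have a unique minimizer, characterized by a vanishing sum of
gradients. -/
theorem exists_isOptimal {n : ℕ} [NeZero n] {f : Fin n → Vec d → ℝ} {v l : Fin n → ℝ}
    (hf : ∀ i, StronglyConvexSmooth (f i) (v i) (l i)) :
    ∃ z, IsOptimal f z ∧ (∀ z', IsOptimal f z' → z' = z) ∧ ∑ i, gradient (f i) z = 0 := by
  have hgrad : ∀ x, HasGradientAt (fun x => ∑ i, f i x) (∑ i, gradient (f i) x) x := fun x => by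
    rw [hasGradientAt_iff_hasFDerivAt, map_sum]
    exact HasFDerivAt.fun_sum fun i _ => ((hf i).differentiable x).hasGradientAt.hasFDerivAt
  have hd : Differentiable ℝ fun x => ∑ i, f i x := fun x => (hgrad x).differentiableAt
  have hpos : 0 < ∑ i, v i := Finset.sum_pos (fun i _ => (hf i).modulus_pos) Finset.univ_nonempty
  have hmono : ∀ x x' : Vec d, (∑ i, v i) * ‖x' - x‖ ^ 2 ≤
      inner ℝ (gradient (fun x => ∑ i, f i x) x' - gradient (fun x => ∑ i, f i x) x) (x' - x) := by
    intro x x'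
    rw [(hgrad x).gradient, (hgrad x').gradient, ← Finset.sum_sub_distrib, sum_inner,
      Finset.sum_mul]
    exact Finset.sum_le_sum fun i _ => (hf i).strong x x'
  obtain ⟨z, hz⟩ := exists_minimizer hpos hd hmono
  have hz0 : ∑ i, gradient (f i) z = 0 := by
    have h1 : IsLocalMin (fun x => ∑ i, f i x) z := Filter.Eventually.of_forall hz
    have h2 := h1.fderiv_eq_zero
    rw [← (hgrad z).gradient, gradient, h2, map_zero]
  refine ⟨z, hz, fun z' hz' => ?_, hz0⟩
  have h := quadratic_lower_model hd hmono z (z' - z)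
  rw [(hgrad z).gradient, hz0, inner_zero_left, add_sub_cancel] at h
  have h' := hz' z
  have h2 : ‖z' - z‖ ^ 2 ≤ 0 := by
    refine le_of_mul_le_mul_left ?_ (half_pos hpos)
    linarith
  exact sub_eq_zero.1 (norm_eq_zero.1 (pow_eq_zero_iff two_ne_zero |>.1 (h2.antisymm (sq_nonneg _))))

end CCDQM

/-! ### Compression of a random input with a fresh seed. -/

theorem MeasureTheory.MemLp.integrable_real_inner {Ω H : Type*} [MeasurableSpace Ω] {P : Measure Ω}
    [NormedAddCommGroup H] [InnerProductSpace ℝ H] {f g : Ω → H} (hf : MemLp f 2 P)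
    (hg : MemLp g 2 P) : Integrable (fun ω => inner ℝ (f ω) (g ω)) P :=
  (hf.norm.integrable_mul hg.norm).mono (hf.1.inner hg.1) (Filter.Eventually.of_forall fun ω => by
    simpa using abs_real_inner_le_norm (f ω) (g ω))

theorem MeasureTheory.MemLp.integrable_norm_sq {Ω H : Type*} [MeasurableSpace Ω] {P : Measure Ω}
    [NormedAddCommGroup H] {f : Ω → H} (hf : MemLp f 2 P) :
    Integrable (fun ω => ‖f ω‖ ^ 2) P := hf.norm.integrable_sq

namespace CCDQM
variable {d : ℕ} {S : Type u} [MeasurableSpace S] {ν : Measure S} {C : S → Vec d → Vec d} {δ : ℝ}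

section Compression

theorem IsContractive.measurable_sq (hC : IsContractive ν C δ) :
    Measurable fun q : S × Vec d => ‖q.2 - C q.1 q.2‖ ^ 2 :=
  (measurable_snd.sub hC.measurable).norm.pow_const 2

variable {Ω : Type w} {m mΩ : MeasurableSpace Ω} {P : Measure Ω} [IsProbabilityMeasure P]
  {ξ : Ω → S} {X W : Ω → Vec d}

/-- Freshness makes the joint law of seed and history a product, so expectations can be computed by
Fubini with the history frozen. -/
theorem map_prodMk_eq_of_indep {β : Type*} [MeasurableSpace β] (hm : m ≤ mΩ) (hξ : Measurable ξ)
    (hlaw : P.map ξ = ν) (hind : Indep (MeasurableSpace.comap ξ inferInstance) m P) {Y : Ω → β}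
    (hY : Measurable[m] Y) :
    P.map (fun ω => (ξ ω, Y ω)) = ν.prod (P.map Y) := by
  have h : IndepFun ξ Y P := by
    rw [IndepFun_iff_Indep]
    exact indep_of_indep_of_le_right hind hY.comap_le
  rw [h.map_prod_eq_prod_map_map hξ.aemeasurable (hY.mono hm le_rfl).aemeasurable, hlaw]

variable [IsProbabilityMeasure ν]

theorem IsContractive.integrable_prod (hC : IsContractive ν C δ) {κ : Measure (Vec d)}
    [IsProbabilityMeasure κ] (hκ : Integrable (fun x => ‖x‖ ^ 2) κ) :
    Integrable (fun q : S × Vec d => ‖q.2 - C q.1 q.2‖ ^ 2) (ν.prod κ) := by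
  have hm := hC.measurable_sq.aestronglyMeasurable (μ := ν.prod κ)
  rw [integrable_prod_iff' hm]
  refine ⟨Filter.Eventually.of_forall hC.integrable, (hκ.const_mul δ).mono'
    hm.norm.prod_swap.integral_prod_right' (Filter.Eventually.of_forall fun x => ?_)⟩
  rw [Real.norm_of_nonneg (integral_nonneg fun s => norm_nonneg _)]
  simpa using hC.contractive x

theorem IsContractive.integral_prod_le (hC : IsContractive ν C δ) {κ : Measure (Vec d)}
    [IsProbabilityMeasure κ] (hκ : Integrable (fun x => ‖x‖ ^ 2) κ) :
    ∫ q, ‖q.2 - C q.1 q.2‖ ^ 2 ∂(ν.prod κ) ≤ δ * ∫ x, ‖x‖ ^ 2 ∂κ := by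
  rw [integral_prod_symm _ (hC.integrable_prod hκ), ← integral_const_mul]
  exact integral_mono (hC.integrable_prod hκ).integral_prod_right (hκ.const_mul δ)
    fun x => hC.contractive x

/-- The compression error of a square-integrable input with a fresh seed is square-integrable, with
second moment at most `δ` times that of the input. -/
theorem IsContractive.memLp_error_and_integral_le (hC : IsContractive ν C δ) (hm : m ≤ mΩ)
    (hξ : Measurable ξ) (hlaw : P.map ξ = ν)
    (hind : Indep (MeasurableSpace.comap ξ inferInstance) m P) (hX : Measurable[m] X)
    (hX2 : MemLp X 2 P) :
    MemLp (fun ω => C (ξ ω) (X ω) - X ω) 2 P ∧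
      ∫ ω, ‖C (ξ ω) (X ω) - X ω‖ ^ 2 ∂P ≤ δ * ∫ ω, ‖X ω‖ ^ 2 ∂P := by
  have hX' : Measurable X := hX.mono hm le_rfl
  have hmap := map_prodMk_eq_of_indep hm hξ hlaw hind hX
  have : IsProbabilityMeasure (P.map X) := Measure.isProbabilityMeasure_map hX'.aemeasurable
  have hpair : Measurable fun ω => (ξ ω, X ω) := hξ.prodMk hX'
  have hκ : Integrable (fun x => ‖x‖ ^ 2) (P.map X) :=
    (integrable_map_measure (measurable_norm.pow_const 2).aestronglyMeasurable
      hX'.aemeasurable).2 hX2.integrable_norm_sq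
  have hsq : Integrable (fun ω => ‖C (ξ ω) (X ω) - X ω‖ ^ 2) P := by
    have h := hC.integrable_prod hκ
    rw [← hmap, integrable_map_measure hC.measurable_sq.aestronglyMeasurable
      hpair.aemeasurable] at h
    simpa only [Function.comp_def, norm_sub_rev] using h
  have hmeas : Measurable fun ω => C (ξ ω) (X ω) - X ω := (hC.measurable.comp hpair).sub hX'
  refine ⟨(memLp_two_iff_integrable_sq_norm hmeas.aestronglyMeasurable).2 hsq, ?_⟩
  have h := hC.integral_prod_le hκ
  rw [← hmap, integral_map hpair.aemeasurable hC.measurable_sq.aestronglyMeasurable,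
    integral_map hX'.aemeasurable (measurable_norm.pow_const 2).aestronglyMeasurable] at h
  simpa only [norm_sub_rev] using h

/-- The error of an unbiased compression with a fresh seed is uncorrelated with the past. -/
theorem IsUnbiased.integral_inner_error (hC : IsContractive ν C δ) (hunb : IsUnbiased ν C)
    (hm : m ≤ mΩ) (hξ : Measurable ξ) (hlaw : P.map ξ = ν)
    (hind : Indep (MeasurableSpace.comap ξ inferInstance) m P) (hX : Measurable[m] X)
    (hX2 : MemLp X 2 P) (hW : Measurable[m] W) (hW2 : MemLp W 2 P) :
    ∫ ω, inner ℝ (W ω) (C (ξ ω) (X ω) - X ω) ∂P = 0 := by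
  have hX' : Measurable X := hX.mono hm le_rfl
  have hW' : Measurable W := hW.mono hm le_rfl
  have hmap := map_prodMk_eq_of_indep hm hξ hlaw hind (hX.prodMk hW)
  have hpair : Measurable fun ω => (ξ ω, X ω, W ω) := hξ.prodMk (hX'.prodMk hW')
  have hg : Measurable fun q : S × Vec d × Vec d => inner ℝ q.2.2 (C q.1 q.2.1 - q.2.1) :=
    measurable_snd.snd.inner
      ((hC.measurable.comp (measurable_fst.prodMk measurable_snd.fst)).sub measurable_snd.fst)
  have hint : Integrable (fun q : S × Vec d × Vec d => inner ℝ q.2.2 (C q.1 q.2.1 - q.2.1))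
      (ν.prod (P.map fun ω => (X ω, W ω))) := by
    rw [← hmap, integrable_map_measure hg.aestronglyMeasurable hpair.aemeasurable]
    exact hW2.integrable_real_inner (hC.memLp_error_and_integral_le hm hξ hlaw hind hX hX2).1
  have : IsProbabilityMeasure (P.map fun ω => (X ω, W ω)) :=
    Measure.isProbabilityMeasure_map (hX'.prodMk hW').aemeasurable
  have h1 : ∫ ω, inner ℝ (W ω) (C (ξ ω) (X ω) - X ω) ∂P
      = ∫ q : S × Vec d × Vec d, inner ℝ q.2.2 (C q.1 q.2.1 - q.2.1)
        ∂(ν.prod (P.map fun ω => (X ω, W ω))) := by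
    rw [← hmap, integral_map hpair.aemeasurable hg.aestronglyMeasurable]
  -- Integrating over the seed first, at a fixed history (X, W), leaves ⟨W, 𝔼 C(X) - X⟩, which
  -- vanishes by unbiasedness.
  rw [h1, integral_prod_symm _ hint]
  refine integral_eq_zero_of_ae (Filter.Eventually.of_forall fun q => ?_)
  have hi := (hunb q.1).1.sub (integrable_const q.1)
  have h2 := (innerSL ℝ q.2).integral_comp_comm hi
  simp only [innerSL_apply_apply, Pi.sub_apply] at h2
  simp only [Pi.zero_apply]
  rw [h2, integral_sub (hunb q.1).1 (integrable_const q.1), (hunb q.1).2]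
  simp

end Compression

/-! ### Measurability and square integrability of the primal update. -/

section Run

variable {n : ℕ} {G : SimpleGraph (Fin n)} [DecidableRel G.Adj] {f : Fin n → Vec d → ℝ}
  {v l : Fin n → ℝ} {c : ℝ}

/-- The primal update as a function of the state is measurable. -/
theorem measurable_nextX (hf : ∀ i, StronglyConvexSmooth (f i) (v i) (l i)) (hc : 0 ≤ c)
    {Ω : Type w} {m : MeasurableSpace Ω} {Z : Ω → State n d}
    (hx : ∀ i, Measurable fun ω => (Z ω).x i) (hy : ∀ i, Measurable fun ω => (Z ω).y i)
    (hφ : ∀ i, Measurable fun ω => (Z ω).φ i) (i : Fin n) :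
    Measurable fun ω => nextX G f c (Z ω) i := by
  have hg : Measurable fun ω => gradient (f i) ((Z ω).x i)
      + c • ∑ j ∈ G.neighborFinset i, ((Z ω).y i - (Z ω).y j) + (Z ω).φ i :=
    (((hf i).differentiable_gradient.continuous.measurable.comp (hx i)).add
      ((Finset.measurable_fun_sum _ fun j _ => (hy i).sub (hy j)).const_smul c)).add (hφ i)
  have ha : 0 ≤ 2 * c * (G.degree i : ℝ) := by positivity
  have hinv := ((hf i).measurable_inverse_regularized_apply ha).comp ((hy i).prodMk hg)
  exact (hx i).sub hinv

theorem memLp_gradient_comp (hf : ∀ i, StronglyConvexSmooth (f i) (v i) (l i))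
    {Ω : Type w} {mΩ : MeasurableSpace Ω} {P : Measure Ω} [IsProbabilityMeasure P]
    {X : Ω → Vec d} (hX : MemLp X 2 P) (i : Fin n) :
    MemLp (fun ω => gradient (f i) (X ω)) 2 P := by
  have h1 : MemLp (fun ω => gradient (f i) (X ω) - gradient (f i) 0) 2 P :=
    hX.of_le_mul (c := l i)
      (((hf i).differentiable_gradient.continuous.comp_aestronglyMeasurable hX.1).sub
        aestronglyMeasurable_const)
      (Filter.Eventually.of_forall fun ω => by simpa using (hf i).lipschitz 0 (X ω))
  exact (h1.add (memLp_const (gradient (f i) 0))).ae_eq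
    (Filter.Eventually.of_forall fun ω => by simp)

/-- The inverse of the regularized Hessian has norm at most 1/v_i, so the increment is dominated by
its argument, which grows at most linearly in the state because the gradient is Lipschitz. -/
theorem memLp_nextX (hf : ∀ i, StronglyConvexSmooth (f i) (v i) (l i)) (hc : 0 ≤ c)
    {Ω : Type w} {mΩ : MeasurableSpace Ω} {P : Measure Ω} [IsProbabilityMeasure P]
    {Z : Ω → State n d} (hxm : ∀ i, Measurable fun ω => (Z ω).x i)
    (hym : ∀ i, Measurable fun ω => (Z ω).y i) (hφm : ∀ i, Measurable fun ω => (Z ω).φ i)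
    (hx : ∀ i, MemLp (fun ω => (Z ω).x i) 2 P) (hy : ∀ i, MemLp (fun ω => (Z ω).y i) 2 P)
    (hφ : ∀ i, MemLp (fun ω => (Z ω).φ i) 2 P) (i : Fin n) :
    MemLp (fun ω => nextX G f c (Z ω) i) 2 P := by
  have hg : MemLp (fun ω => gradient (f i) ((Z ω).x i)
      + c • ∑ j ∈ G.neighborFinset i, ((Z ω).y i - (Z ω).y j) + (Z ω).φ i) 2 P :=
    ((memLp_gradient_comp hf (hx i) i).add
      ((memLp_finsetSum _ fun j _ => (hy i).sub (hy j)).const_smul c)).add (hφ i)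
  have hstep : MemLp (fun ω => nextX G f c (Z ω) i - (Z ω).x i) 2 P := by
    refine hg.of_le_mul (c := (v i)⁻¹)
      ((measurable_nextX hf hc hxm hym hφm i).sub (hxm i)).aestronglyMeasurable
      (Filter.Eventually.of_forall fun ω => ?_)
    have h := (hf i).norm_inverse_regularized_le (a := 2 * c * (G.degree i : ℝ)) (by positivity)
      ((Z ω).y i) (gradient (f i) ((Z ω).x i)
        + c • ∑ j ∈ G.neighborFinset i, ((Z ω).y i - (Z ω).y j) + (Z ω).φ i)
    rw [nextX, sub_sub_cancel_left, norm_neg]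
    exact h
  exact (hstep.add (hx i)).ae_eq (Filter.Eventually.of_forall fun ω => by simp)

theorem nextY_zero {S : Type u} (C : S → Vec d → Vec d) (s : Fin n → S) (z : State n d) (i : Fin n) :
    nextY G f c C 0 s z i = C (s i) (nextX G f c z i - z.y i) + z.y i := by
  rw [nextY, if_pos (norm_nonneg _)]

end Run

end CCDQM

/-! ### The Lyapunov contraction in expectation. -/

theorem integrable_lyapunov {Ω : Type w} [MeasurableSpace Ω] {P : Measure Ω} [IsFiniteMeasure P]
    {H : Type*} [NormedAddCommGroup H] [InnerProductSpace ℝ H] (L U : H →L[ℝ] H) {c θ : ℝ} (xs : H)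
    {X Y D : Ω → H} (hX : MemLp X 2 P) (hY : MemLp Y 2 P) (hD : MemLp D 2 P) :
    Integrable (fun ω => lyapunov L U c θ xs (X ω) (Y ω) (D ω)) P := by
  have h1 : MemLp (fun ω => X ω - xs) 2 P := hX.sub (memLp_const xs)
  exact ((((U.comp_memLp' h1).integrable_real_inner h1).const_mul _).add
    (((L.comp_memLp' hD).integrable_real_inner hD).const_mul _)).add
    ((hY.sub hX).integrable_norm_sq.const_mul _)

/-- Integrated form of the contraction of the Lyapunov function. -/
theorem integral_lyapunov_contraction {Ω : Type w} [MeasurableSpace Ω] {P : Measure Ω}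
    [IsProbabilityMeasure P] {H : Type*} [NormedAddCommGroup H] [InnerProductSpace ℝ H]
    (L U : H →L[ℝ] H) {c θ ρ b δ : ℝ} (hb : 0 ≤ b) (xs : H) {X X' Y Y' D D' : Ω → H}
    (hX : MemLp X 2 P) (hX' : MemLp X' 2 P) (hY : MemLp Y 2 P) (hY' : MemLp Y' 2 P)
    (hD : MemLp D 2 P) (hD' : MemLp D' 2 P)
    (hpt : ∀ ω, (1 + ρ) * lyapunov L U c θ xs (X' ω) (Y' ω) (D' ω)
      ≤ lyapunov L U c θ xs (X ω) (Y ω) (D ω)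
        + b * (‖Y' ω - X' ω‖ ^ 2 - δ * ‖X' ω - Y ω‖ ^ 2)
        + c * inner ℝ (L (X' ω + D ω)) (Y' ω - X' ω))
    (herr : ∫ ω, ‖Y' ω - X' ω‖ ^ 2 ∂P ≤ δ * ∫ ω, ‖X' ω - Y ω‖ ^ 2 ∂P)
    (horth : ∫ ω, inner ℝ (L (X' ω + D ω)) (Y' ω - X' ω) ∂P = 0) :
    (1 + ρ) * ∫ ω, lyapunov L U c θ xs (X' ω) (Y' ω) (D' ω) ∂P
      ≤ ∫ ω, lyapunov L U c θ xs (X ω) (Y ω) (D ω) ∂P := by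
  have hV := integrable_lyapunov L U (c := c) (θ := θ) xs hX hY hD
  have hV' := integrable_lyapunov L U (c := c) (θ := θ) xs hX' hY' hD'
  have hE1 : Integrable (fun ω => ‖Y' ω - X' ω‖ ^ 2) P := (hY'.sub hX').integrable_norm_sq
  have hE2 : Integrable (fun ω => δ * ‖X' ω - Y ω‖ ^ 2) P :=
    (hX'.sub hY).integrable_norm_sq.const_mul δ
  have hE3 : Integrable (fun ω => b * (‖Y' ω - X' ω‖ ^ 2 - δ * ‖X' ω - Y ω‖ ^ 2)) P :=
    (hE1.sub hE2).const_mul b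
  have hE4 : Integrable (fun ω => c * inner ℝ (L (X' ω + D ω)) (Y' ω - X' ω)) P :=
    ((L.comp_memLp' (hX'.add hD)).integrable_real_inner (hY'.sub hX')).const_mul c
  have hE5 := hV.add hE3
  have h := integral_mono (hV'.const_mul (1 + ρ)) (hE5.add hE4) hpt
  have e1 := integral_add hE5 hE4
  have e2 := integral_add hV hE3
  have e3 := integral_sub hE1 hE2
  simp only [Pi.add_apply] at h e1
  rw [e1, e2, integral_const_mul, integral_const_mul, integral_const_mul, e3, integral_const_mul,
    horth] at h
  have := mul_nonneg hb (sub_nonneg.2 herr)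
  linarith

/-! ### One step of the algorithm in stacked form. -/

namespace CCDQM

variable {n d : ℕ}

/-- The stacked vector of the agents' variables. -/
def stack (a : Fin n → Vec d) : Stack n d := WithLp.toLp 2 a

theorem stack_apply (a : Fin n → Vec d) (i : Fin n) : stack a i = a i := rfl

theorem norm_le_of_forall_norm_le {a b : Stack n d} {B : ℝ} (hB : 0 ≤ B)
    (h : ∀ i, ‖a i‖ ≤ B * ‖b i‖) : ‖a‖ ≤ B * ‖b‖ := by
  refine (pow_le_pow_iff_left₀ (norm_nonneg _) (by positivity) two_ne_zero).1 ?_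
  rw [mul_pow, PiLp.norm_sq_eq_of_L2, PiLp.norm_sq_eq_of_L2, Finset.mul_sum]
  refine Finset.sum_le_sum fun i _ => ?_
  rw [← mul_pow]
  exact pow_le_pow_left₀ (norm_nonneg _) (h i) 2

section Deterministic

variable {G : SimpleGraph (Fin n)} [DecidableRel G.Adj] {f : Fin n → Vec d → ℝ}
  {v l : Fin n → ℝ} {c : ℝ}

/-- The primal update in implicit form. -/
theorem nextX_equation (hf : ∀ i, StronglyConvexSmooth (f i) (v i) (l i)) (hc : 0 ≤ c)
    (z : State n d) {p : Stack n d} (hp : stack z.φ = c • matOp (G.lapMatrix ℝ) p) :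
    stack (fun i => gradient (f i) (z.x i) + hessian (f i) (z.y i) (nextX G f c z i - z.x i))
      + c • matOp (unsignedLap G) (stack (nextX G f c z) - stack z.x)
      + c • matOp (G.lapMatrix ℝ) (stack (nextX G f c z) - stack z.x)
      + c • matOp (G.lapMatrix ℝ) (stack z.y) + c • matOp (G.lapMatrix ℝ) p = 0 := by
  rw [← hp]
  ext1 i
  have hinv := (hf i).isInvertible_regularized (a := 2 * c * (G.degree i : ℝ)) (by positivity)
    (z.y i)
  -- Applying the regularized Hessian to the increment removes the inverse and leaves a linear
  -- equation for the new point.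
  have h1 := hinv.self_apply_inverse (gradient (f i) (z.x i)
    + c • ∑ j ∈ G.neighborFinset i, (z.y i - z.y j) + z.φ i)
  have h2 : nextX G f c z i - z.x i = -((2 * c * (G.degree i : ℝ)) •
      ContinuousLinearMap.id ℝ (Vec d) + hessian (f i) (z.y i)).inverse
      (gradient (f i) (z.x i) + c • ∑ j ∈ G.neighborFinset i, (z.y i - z.y j) + z.φ i) := by
    rw [nextX, sub_sub_cancel_left]
  rw [← neg_neg (ContinuousLinearMap.inverse _ _), ← h2, map_neg, add_apply, smul_apply,
    ContinuousLinearMap.id_apply] at h1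
  have h3 := matOp_lap_add_unsignedLap_apply G (stack (nextX G f c z) - stack z.x) i
  have h4 := matOp_lap_apply G (stack z.y) i
  simp only [PiLp.add_apply, PiLp.smul_apply, PiLp.zero_apply, h4, stack_apply] at h3 ⊢
  rw [PiLp.sub_apply, stack_apply, stack_apply] at h3
  linear_combination (norm := module) c • h3 - h1


/-- One step of the algorithm contracts the Lyapunov function, whatever the transmitted estimates,
up to the terms that depend on the compression error. -/
theorem exists_contraction (hG : G.Connected) (hf : ∀ i, StronglyConvexSmooth (f i) (v i) (l i))
    {vmin B s : ℝ} (hv0 : 0 < vmin) (hv : ∀ i, vmin ≤ v i) (hB : 0 ≤ B) (hl : ∀ i, l i ≤ B)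
    (hs0 : 0 ≤ s) (hs1 : s < 1) (hc : 0 < c) (hlam : 0 < lapEigMax G)
    (hcond : B ^ 2 < vmin * (c / 2 * (unsignedLapEigMin G
      - 3 * lapEigMax G * (s ^ 2 / (1 - s) ^ 2)))) {z₀ : Vec d}
    (hz₀ : ∑ i, gradient (f i) z₀ = 0) :
    ∃ (ps : Stack n d) (θ ρ b : ℝ), 0 ≤ θ ∧ 0 < ρ ∧ 0 ≤ b ∧
      ∀ (z : State n d) (p y' : Stack n d), stack z.φ = c • matOp (G.lapMatrix ℝ) p →
      (1 + ρ) * lyapunov (matOp (G.lapMatrix ℝ)) (matOp (unsignedLap G)) c θ (stack fun _ => z₀)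
          (stack (nextX G f c z)) y' (p + y' - ps)
        ≤ lyapunov (matOp (G.lapMatrix ℝ)) (matOp (unsignedLap G)) c θ (stack fun _ => z₀)
          (stack z.x) (stack z.y) (p - ps)
        + b * (‖y' - stack (nextX G f c z)‖ ^ 2
          - s ^ 2 * ‖stack (nextX G f c z) - stack z.y‖ ^ 2)
        + c * inner ℝ (matOp (G.lapMatrix ℝ) (stack (nextX G f c z) + (p - ps)))
          (y' - stack (nextX G f c z)) := by
  set L : Stack n d →L[ℝ] Stack n d := matOp (G.lapMatrix ℝ) with hLdef
  set U : Stack n d →L[ℝ] Stack n d := matOp (unsignedLap G) with hUdef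
  have hxs : L (stack fun _ => z₀) = 0 := matOp_lap_const z₀
  -- The dual optimum is -q/c: c times its Laplacian cancels the stacked gradients at the minimizer.
  obtain ⟨q, hq⟩ := exists_matOp_lap_eq (G := G) hG
    (g := stack fun i => gradient (f i) z₀) hz₀
  have hps : c • L (-(c⁻¹ • q)) = -stack fun i => gradient (f i) z₀ := by
    rw [map_neg, map_smul, smul_neg, smul_smul, mul_inv_cancel₀ hc.ne', one_smul, hLdef, hq]
  obtain ⟨θ, ρ, b, hθ, hρ, hb, hmain⟩ := exists_lyapunov_contraction L U
    (inner_matOp_comm (lap_isHermitian G)) (inner_matOp_comm (unsignedLap_isHermitian G))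
    (inner_matOp_lap_nonneg G) (inner_matOp_self_le (lap_isHermitian G))
    (le_inner_matOp_self (unsignedLap_isHermitian G)) hlam hc hv0 hB hs0 hs1 hcond
  refine ⟨-(c⁻¹ • q), θ, ρ, b, hθ, hρ, hb, fun z p y' hp => ?_⟩
  have heq := nextX_equation hf hc.le z hp
  rw [← hLdef, ← hUdef] at heq
  set x' := nextX G f c z with hx'
  -- The gradient term is split into g, the gradient difference between x' and the minimizer, and e,
  -- the error of linearizing the gradient from x to x' with the Hessian taken at y. Lipschitz
  -- continuity bounds each half of e by ℓ‖x' - x‖, whatever y is.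
  refine hmain (stack fun _ => z₀) (stack z.x) (stack x') (stack z.y) y' (p - -(c⁻¹ • q))
    (p + y' - -(c⁻¹ • q)) (stack fun i => gradient (f i) (x' i) - gradient (f i) z₀)
    (stack fun i => gradient (f i) (z.x i) - gradient (f i) (x' i)
      + hessian (f i) (z.y i) (x' i - z.x i)) hxs (by abel) ?_ ?_ ?_ ?_
  · have hsum : (stack fun i => gradient (f i) (x' i) - gradient (f i) z₀)
        + (stack fun i => gradient (f i) (z.x i) - gradient (f i) (x' i)
          + hessian (f i) (z.y i) (x' i - z.x i))
        = (stack fun i => gradient (f i) (z.x i) + hessian (f i) (z.y i) (x' i - z.x i))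
          - stack fun i => gradient (f i) z₀ := by
      ext1 i
      simp only [PiLp.add_apply, PiLp.sub_apply, stack_apply]
      abel
    rw [hsum]
    simp only [map_add, map_sub] at heq ⊢
    linear_combination (norm := module) heq - hps
  · rw [PiLp.norm_sq_eq_of_L2, PiLp.inner_apply, Finset.mul_sum]
    refine Finset.sum_le_sum fun i _ => le_trans ?_ ((hf i).strong z₀ (x' i))
    rw [PiLp.sub_apply, stack_apply, stack_apply]
    gcongr
    exact hv i
  · refine norm_le_of_forall_norm_le hB fun i => ((hf i).lipschitz z₀ (x' i)).trans ?_
    rw [PiLp.sub_apply, stack_apply, stack_apply]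
    gcongr
    exact hl i
  · refine norm_le_of_forall_norm_le (by positivity) fun i => ?_
    rw [PiLp.sub_apply, stack_apply, stack_apply, stack_apply]
    have h1 := (hf i).lipschitz (x' i) (z.x i)
    have h2 := (hf i).norm_hessian_apply_le hB (hl i) (z.y i) (x' i - z.x i)
    have h3 := mul_le_mul_of_nonneg_right (hl i) (norm_nonneg (z.x i - x' i))
    rw [norm_sub_rev (z.x i) (x' i)] at h1 h3
    have h4 := norm_add_le (gradient (f i) (z.x i) - gradient (f i) (x' i))
      (hessian (f i) (z.y i) (x' i - z.x i))
    linarith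

/-- The lower bound of the Lyapunov function by the distance to the optimum. -/
theorem sq_norm_le_lyapunov {θ : ℝ} (hc : 0 ≤ c) (hθ : 0 ≤ θ) (xs x y p : Stack n d) :
    c / 2 * unsignedLapEigMin G * ‖x - xs‖ ^ 2
      ≤ lyapunov (matOp (G.lapMatrix ℝ)) (matOp (unsignedLap G)) c θ xs x y p := by
  have h1 := mul_le_mul_of_nonneg_left
    (le_inner_matOp_self (unsignedLap_isHermitian G) (x - xs)) (by positivity : 0 ≤ c / 2)
  have h2 := mul_nonneg (by positivity : 0 ≤ c / 2) (inner_matOp_lap_nonneg G p)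
  have h3 : 0 ≤ θ * ‖y - x‖ ^ 2 := by positivity
  rw [lyapunov, unsignedLapEigMin]
  linarith

end Deterministic

/-! ### Moments of one random step. -/

section Random

variable {Ω : Type w} {m m' mΩ : MeasurableSpace Ω} {P : Measure Ω}

/-- A random state that is measurable with respect to `m` and square-integrable. -/
structure IsAdaptedL2 (m : MeasurableSpace Ω) {mΩ : MeasurableSpace Ω} (P : Measure Ω)
    (Z : Ω → State n d) : Prop where
  measurable_x : ∀ i, Measurable[m] fun ω => (Z ω).x i
  measurable_y : ∀ i, Measurable[m] fun ω => (Z ω).y i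
  measurable_φ : ∀ i, Measurable[m] fun ω => (Z ω).φ i
  memLp_x : ∀ i, MemLp (fun ω => (Z ω).x i) 2 P
  memLp_y : ∀ i, MemLp (fun ω => (Z ω).y i) 2 P
  memLp_φ : ∀ i, MemLp (fun ω => (Z ω).φ i) 2 P

variable {G : SimpleGraph (Fin n)} [DecidableRel G.Adj] {f : Fin n → Vec d → ℝ}
  {v l : Fin n → ℝ} {c : ℝ} {S : Type u} [MeasurableSpace S] {ν : Measure S}
  {C : S → Vec d → Vec d} {δ : ℝ}

theorem IsAdaptedL2.measurable_nextX {Z : Ω → State n d} (hZ : IsAdaptedL2 m P Z)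
    (hf : ∀ i, StronglyConvexSmooth (f i) (v i) (l i)) (hc : 0 ≤ c) (i : Fin n) :
    Measurable[m] fun ω => nextX G f c (Z ω) i :=
  CCDQM.measurable_nextX hf hc hZ.measurable_x hZ.measurable_y hZ.measurable_φ i

variable [IsProbabilityMeasure P]

theorem IsAdaptedL2.memLp_nextX {Z : Ω → State n d} (hZ : IsAdaptedL2 m P Z) (hm : m ≤ mΩ)
    (hf : ∀ i, StronglyConvexSmooth (f i) (v i) (l i)) (hc : 0 ≤ c) (i : Fin n) :
    MemLp (fun ω => nextX G f c (Z ω) i) 2 P :=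
  CCDQM.memLp_nextX hf hc (fun j => (hZ.measurable_x j).mono hm le_rfl)
    (fun j => (hZ.measurable_y j).mono hm le_rfl) (fun j => (hZ.measurable_φ j).mono hm le_rfl)
    hZ.memLp_x hZ.memLp_y hZ.memLp_φ i

variable [IsProbabilityMeasure ν]

/-- The next state, when every innovation is transmitted, is again square-integrable, and is known
once the seeds are. -/
theorem IsAdaptedL2.next {Z : Ω → State n d} (hZ : IsAdaptedL2 m P Z)
    (hf : ∀ i, StronglyConvexSmooth (f i) (v i) (l i)) (hc : 0 ≤ c) (hC : IsContractive ν C δ)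
    (hmm' : m ≤ m') (hm' : m' ≤ mΩ) {ξ : Fin n → Ω → S} (hξ : ∀ i, Measurable[m'] (ξ i))
    (hlaw : ∀ i, P.map (ξ i) = ν)
    (hind : ∀ i, Indep (MeasurableSpace.comap (ξ i) inferInstance) m P) :
    IsAdaptedL2 m' P fun ω => ⟨nextX G f c (Z ω), nextY G f c C 0 (fun i => ξ i ω) (Z ω),
      nextφ G f c C 0 (fun i => ξ i ω) (Z ω)⟩ := by
  have hm := hmm'.trans hm'
  have hX := fun i => hZ.measurable_nextX (G := G) hf hc i
  have hX2 := fun i => hZ.memLp_nextX (G := G) hm hf hc i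
  have hY : ∀ i, Measurable[m'] fun ω => nextY G f c C 0 (fun i => ξ i ω) (Z ω) i := fun i => by
    simp only [nextY_zero]
    have hu : Measurable[m'] fun ω => nextX G f c (Z ω) i - (Z ω).y i :=
      ((hX i).sub (hZ.measurable_y i)).mono hmm' le_rfl
    have hCu : Measurable[m'] fun ω => C (ξ i ω) (nextX G f c (Z ω) i - (Z ω).y i) :=
      hC.measurable.comp ((hξ i).prodMk hu)
    exact hCu.add ((hZ.measurable_y i).mono hmm' le_rfl)
  have hY2 : ∀ i, MemLp (fun ω => nextY G f c C 0 (fun i => ξ i ω) (Z ω) i) 2 P := fun i => by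
    have h := (hC.memLp_error_and_integral_le hm ((hξ i).mono hm' le_rfl) (hlaw i) (hind i)
      ((hX i).sub (hZ.measurable_y i)) ((hX2 i).sub (hZ.memLp_y i))).1
    exact (h.add (hX2 i)).ae_eq (Filter.Eventually.of_forall fun ω => by
      simp only [nextY_zero, Pi.add_apply, Pi.sub_apply]; abel)
  exact
    { measurable_x := fun i => (hX i).mono hmm' le_rfl
      measurable_y := hY
      measurable_φ := fun i => ((hZ.measurable_φ i).mono hmm' le_rfl).add
        ((Finset.measurable_fun_sum _ fun j _ => (hY i).sub (hY j)).const_smul c)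
      memLp_x := hX2
      memLp_y := hY2
      memLp_φ := fun i => (hZ.memLp_φ i).add
        ((memLp_finsetSum _ fun j _ => (hY2 i).sub (hY2 j)).const_smul c) }

/-- The mean-square compression error of the stacked estimates. -/
theorem IsAdaptedL2.integral_sq_error_le {Z : Ω → State n d} (hZ : IsAdaptedL2 m P Z)
    (hf : ∀ i, StronglyConvexSmooth (f i) (v i) (l i)) (hc : 0 ≤ c) (hC : IsContractive ν C δ)
    (hm : m ≤ mΩ) {ξ : Fin n → Ω → S} (hξ : ∀ i, Measurable (ξ i))
    (hlaw : ∀ i, P.map (ξ i) = ν)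
    (hind : ∀ i, Indep (MeasurableSpace.comap (ξ i) inferInstance) m P) :
    ∫ ω, ‖stack (nextY G f c C 0 (fun i => ξ i ω) (Z ω)) - stack (nextX G f c (Z ω))‖ ^ 2 ∂P
      ≤ δ * ∫ ω, ‖stack (nextX G f c (Z ω)) - stack (Z ω).y‖ ^ 2 ∂P := by
  have hu : ∀ i, MemLp (fun ω => nextX G f c (Z ω) i - (Z ω).y i) 2 P :=
    fun i => (hZ.memLp_nextX hm hf hc i).sub (hZ.memLp_y i)
  have hum : ∀ i, Measurable[m] fun ω => nextX G f c (Z ω) i - (Z ω).y i :=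
    fun i => (hZ.measurable_nextX hf hc i).sub (hZ.measurable_y i)
  have h := fun i => hC.memLp_error_and_integral_le hm (hξ i) (hlaw i) (hind i) (hum i) (hu i)
  have h1 : ∀ ω, ‖stack (nextY G f c C 0 (fun i => ξ i ω) (Z ω)) - stack (nextX G f c (Z ω))‖ ^ 2
      = ∑ i, ‖C (ξ i ω) (nextX G f c (Z ω) i - (Z ω).y i)
        - (nextX G f c (Z ω) i - (Z ω).y i)‖ ^ 2 := fun ω => by
    rw [PiLp.norm_sq_eq_of_L2]
    refine Finset.sum_congr rfl fun i _ => ?_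
    rw [PiLp.sub_apply, stack_apply, stack_apply, nextY_zero]
    congr 2
    abel
  have h2 : ∀ ω, ‖stack (nextX G f c (Z ω)) - stack (Z ω).y‖ ^ 2
      = ∑ i, ‖nextX G f c (Z ω) i - (Z ω).y i‖ ^ 2 := fun ω => PiLp.norm_sq_eq_of_L2 _ _
  simp only [h1, h2]
  rw [integral_finsetSum _ fun i _ => (h i).1.integrable_norm_sq,
    integral_finsetSum _ fun i _ => (hu i).integrable_norm_sq, Finset.mul_sum]
  exact Finset.sum_le_sum fun i _ => (h i).2

/-- The compression error of the stacked estimates is uncorrelated with the past. -/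
theorem IsAdaptedL2.integral_inner_error {Z : Ω → State n d} (hZ : IsAdaptedL2 m P Z)
    (hf : ∀ i, StronglyConvexSmooth (f i) (v i) (l i)) (hc : 0 ≤ c) (hC : IsContractive ν C δ)
    (hunb : IsUnbiased ν C) (hm : m ≤ mΩ) {ξ : Fin n → Ω → S} (hξ : ∀ i, Measurable (ξ i))
    (hlaw : ∀ i, P.map (ξ i) = ν)
    (hind : ∀ i, Indep (MeasurableSpace.comap (ξ i) inferInstance) m P)
    {W : Ω → Stack n d} (hW : ∀ i, Measurable[m] fun ω => W ω i) (hW2 : MemLp W 2 P) :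
    ∫ ω, inner ℝ (W ω) (stack (nextY G f c C 0 (fun i => ξ i ω) (Z ω))
      - stack (nextX G f c (Z ω))) ∂P = 0 := by
  have hum : ∀ i, Measurable[m] fun ω => nextX G f c (Z ω) i - (Z ω).y i :=
    fun i => (hZ.measurable_nextX hf hc i).sub (hZ.measurable_y i)
  have hu : ∀ i, MemLp (fun ω => nextX G f c (Z ω) i - (Z ω).y i) 2 P :=
    fun i => (hZ.memLp_nextX hm hf hc i).sub (hZ.memLp_y i)
  have hW2' := hW2.eval_piLp
  have h := fun i => hC.memLp_error_and_integral_le hm (hξ i) (hlaw i) (hind i) (hum i) (hu i)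
  have h1 : ∀ ω, inner ℝ (W ω) (stack (nextY G f c C 0 (fun i => ξ i ω) (Z ω))
      - stack (nextX G f c (Z ω)))
      = ∑ i, inner ℝ (W ω i) (C (ξ i ω) (nextX G f c (Z ω) i - (Z ω).y i)
        - (nextX G f c (Z ω) i - (Z ω).y i)) := fun ω => by
    rw [PiLp.inner_apply]
    refine Finset.sum_congr rfl fun i _ => ?_
    rw [PiLp.sub_apply, stack_apply, stack_apply, nextY_zero]
    congr 1
    abel
  simp only [h1]
  rw [integral_finsetSum _ fun i _ => (hW2' i).integrable_real_inner (h i).1]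
  exact Finset.sum_eq_zero fun i _ =>
    hunb.integral_inner_error hC hm (hξ i) (hlaw i) (hind i) (hum i) (hu i) (hW i) (hW2' i)

end Random

end CCDQM

/-! ### Whole runs: the accumulated dual variable and the mean-square rate. -/

namespace CCDQM

variable {n d : ℕ} {G : SimpleGraph (Fin n)} [DecidableRel G.Adj] {f : Fin n → Vec d → ℝ}
  {v l : Fin n → ℝ} {c : ℝ} {S : Type u} {C : S → Vec d → Vec d} {δ : ℝ} {μ : ℕ → ℝ}

/-- The dual variables are the Laplacian of the accumulated estimates. -/
theorem stack_run_φ (x0 : Fin n → Vec d) (s : ℕ → Fin n → S) (k : ℕ) :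
    stack (run G f c C μ x0 s k).φ
      = c • matOp (G.lapMatrix ℝ) (∑ j ∈ Finset.range (k + 1), stack (run G f c C μ x0 s j).y) := by
  induction k with
  | zero =>
    -- Including y_0 in the sum is harmless because y_0 = 0, which matches φ_0 = 0.
    have h : stack (run G f c C μ x0 s 0).y = 0 := rfl
    rw [Finset.sum_range_one, h, map_zero, smul_zero]
    rfl
  | succ k ih =>
    rw [Finset.sum_range_succ, map_add, smul_add, ← ih]
    ext1 i
    rw [PiLp.add_apply, PiLp.smul_apply, matOp_lap_apply]
    rfl

variable [MeasurableSpace S] {ν : Measure S} [IsProbabilityMeasure ν]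
  {Ω : Type w} [mΩ : MeasurableSpace Ω] {P : Measure Ω} [IsProbabilityMeasure P]
  {ℱ : Filtration ℕ mΩ} {x0 : Fin n → Ω → Vec d} {ξ : ℕ → Fin n → Ω → S}

theorem isAdaptedL2_run (hf : ∀ i, StronglyConvexSmooth (f i) (v i) (l i)) (hc : 0 ≤ c)
    (hC : IsContractive ν C δ) (hμ : ∀ k, μ k = 0) (hin : IsRandomInput ν P ℱ x0 ξ) (k : ℕ) :
    IsAdaptedL2 (ℱ k) P fun ω =>
      run G f c C μ (fun j => x0 j ω) (fun m j => ξ m j ω) k := by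
  induction k with
  | zero =>
    exact
      { measurable_x := hin.init_measurable
        measurable_y := fun _ => measurable_const
        measurable_φ := fun _ => measurable_const
        memLp_x := hin.init_memLp
        memLp_y := fun _ => memLp_const 0
        memLp_φ := fun _ => memLp_const 0 }
  | succ k ih =>
    have h := ih.next (G := G) hf hc hC (ℱ.mono k.le_succ) (ℱ.le (k + 1)) (hin.seed_measurable k)
      (hin.seed_law k) (hin.seed_fresh k)
    simpa only [run, hμ k] using h

/-- Linear convergence in mean square. -/
theorem exists_rate (hG : G.Connected) (hf : ∀ i, StronglyConvexSmooth (f i) (v i) (l i))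
    {vmin B s : ℝ} (hv0 : 0 < vmin) (hv : ∀ i, vmin ≤ v i) (hB : 0 ≤ B) (hl : ∀ i, l i ≤ B)
    (hs0 : 0 ≤ s) (hs1 : s < 1) (hc : 0 < c) (hlam : 0 < lapEigMax G)
    (hmu : 0 < unsignedLapEigMin G)
    (hcond : B ^ 2 < vmin * (c / 2 * (unsignedLapEigMin G
      - 3 * lapEigMax G * (s ^ 2 / (1 - s) ^ 2)))) {z₀ : Vec d}
    (hz₀ : ∑ i, gradient (f i) z₀ = 0) (hC : IsContractive ν C (s ^ 2)) (hunb : IsUnbiased ν C)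
    (hμ : ∀ k, μ k = 0) :
    ∃ r : ℝ, 0 < r ∧ r < 1 ∧
      ∀ (Ω : Type w) [mΩ : MeasurableSpace Ω] (P : Measure Ω) [IsProbabilityMeasure P]
        (ℱ : Filtration ℕ mΩ) (x0 : Fin n → Ω → Vec d) (ξ : ℕ → Fin n → Ω → S),
        IsRandomInput ν P ℱ x0 ξ → ∃ K : ℝ, ∀ (k : ℕ) (i : Fin n),
          ∫ ω, ‖(run G f c C μ (fun j => x0 j ω) (fun m j => ξ m j ω) k).x i - z₀‖ ^ 2 ∂P
            ≤ K * r ^ k := by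
  obtain ⟨ps, θ, ρ, b, hθ, hρ, hb, hstep⟩ :=
    exists_contraction hG hf hv0 hv hB hl hs0 hs1 hc hlam hcond hz₀
  refine ⟨(1 + ρ)⁻¹, by positivity, inv_lt_one_of_one_lt₀ (by linarith), ?_⟩
  intro Ω mΩ P _ ℱ x0 ξ hin
  have hZ := isAdaptedL2_run (G := G) hf hc.le hC hμ hin
  set Z : ℕ → Ω → State n d := fun k ω =>
    run G f c C μ (fun j => x0 j ω) (fun m j => ξ m j ω) k with hZdef
  set L : Stack n d →L[ℝ] Stack n d := matOp (G.lapMatrix ℝ) with hL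
  set U : Stack n d →L[ℝ] Stack n d := matOp (unsignedLap G) with hU
  set A : ℕ → Ω → Stack n d := fun k ω => ∑ j ∈ Finset.range (k + 1), stack (Z j ω).y with hA
  have hx : ∀ k, MemLp (fun ω => stack (Z k ω).x) 2 P := fun k =>
    MemLp.of_eval_piLp (hZ k).memLp_x
  have hy : ∀ k, MemLp (fun ω => stack (Z k ω).y) 2 P := fun k =>
    MemLp.of_eval_piLp (hZ k).memLp_y
  have hA2 : ∀ k, MemLp (fun ω => A k ω - ps) 2 P := fun k =>
    (memLp_finsetSum _ fun j _ => hy j).sub (memLp_const ps)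
  have hAm : ∀ k i, Measurable[ℱ k] fun ω => A k ω i := fun k i => by
    have h : ∀ ω, A k ω i = ∑ j ∈ Finset.range (k + 1), (Z j ω).y i := fun ω => by
      rw [hA, WithLp.ofLp_sum, Finset.sum_apply]; rfl
    simp only [h]
    exact Finset.measurable_fun_sum _ fun j hj => ((hZ j).measurable_y i).mono
      (ℱ.mono (Nat.lt_succ_iff.1 (Finset.mem_range.1 hj))) le_rfl
  set V : ℕ → ℝ := fun k => ∫ ω, lyapunov L U c θ (stack fun _ => z₀)
    (stack (Z k ω).x) (stack (Z k ω).y) (A k ω - ps) ∂P with hV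
  have hx' : ∀ k ω, (Z (k + 1) ω).x = nextX G f c (Z k ω) := fun k ω => rfl
  have hy' : ∀ k ω, (Z (k + 1) ω).y = nextY G f c C 0 (fun j => ξ k j ω) (Z k ω) := fun k ω => by
    rw [← hμ k]; rfl
  have hdecr : ∀ k, (1 + ρ) * V (k + 1) ≤ V k := by
    intro k
    have hseed : ∀ i, Measurable (ξ k i) := fun i =>
      (hin.seed_measurable k i).mono (ℱ.le (k + 1)) le_rfl
    refine integral_lyapunov_contraction (δ := s ^ 2) L U hb _ (hx k) (hx (k + 1)) (hy k)
      (hy (k + 1)) (hA2 k) (hA2 (k + 1)) (fun ω => ?_) ?_ ?_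
    · have hAs : A (k + 1) ω = A k ω + stack (Z (k + 1) ω).y := Finset.sum_range_succ _ _
      rw [hAs, hx']
      exact hstep (Z k ω) (A k ω) (stack (Z (k + 1) ω).y) (stack_run_φ _ _ k)
    · simp only [hx', hy']
      exact (hZ k).integral_sq_error_le hf hc.le hC (ℱ.le k) hseed (hin.seed_law k)
        (hin.seed_fresh k)
    · simp only [hx', hy']
      -- Both x_{k+1} and the sum of the estimates up to y_k are determined before the seeds of
      -- iteration k are drawn; only y_{k+1} uses them.
      refine (hZ k).integral_inner_error hf hc.le hC hunb (ℱ.le k) hseed (hin.seed_law k)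
        (hin.seed_fresh k) (fun i => ?_) (L.comp_memLp' ((hx (k + 1)).add (hA2 k)))
      simp only [hL, matOp_apply]
      have hsum : ∀ j, Measurable[ℱ k] fun ω =>
          nextX G f c (Z k ω) j + (A k ω j - ps j) := fun j =>
        ((hZ k).measurable_nextX hf hc.le j).add ((hAm k j).sub measurable_const)
      exact Finset.measurable_fun_sum _ fun j _ => (hsum j).const_smul (G.lapMatrix ℝ i j)
  have hgeo : ∀ k, V k ≤ V 0 * (1 + ρ)⁻¹ ^ k := by
    intro k
    induction k with
    | zero => simp
    | succ k ih =>
      have h := (le_inv_mul_iff₀ (by positivity : 0 < 1 + ρ)).2 ((hdecr k).trans ih)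
      rwa [mul_left_comm, ← pow_succ'] at h
  refine ⟨(c / 2 * unsignedLapEigMin G)⁻¹ * V 0, fun k i => ?_⟩
  have hpos : 0 < c / 2 * unsignedLapEigMin G := by positivity
  rw [mul_assoc, le_inv_mul_iff₀ hpos]
  refine le_trans ?_ (hgeo k)
  rw [← integral_const_mul]
  refine integral_mono_of_nonneg (Filter.Eventually.of_forall fun ω => by positivity) ?_
    (Filter.Eventually.of_forall fun ω => le_trans ?_
      (sq_norm_le_lyapunov hc.le hθ _ (stack (Z k ω).x) (stack (Z k ω).y) (A k ω - ps)))
  · exact integrable_lyapunov L U _ (hx k) (hy k) (hA2 k)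
  · refine mul_le_mul_of_nonneg_left ?_ hpos.le
    exact pow_le_pow_left₀ (norm_nonneg _)
      (PiLp.norm_apply_le (stack (Z k ω).x - stack fun _ => z₀) i) 2

end CCDQM

/-! ### From second moments to the bias, and the main theorem. -/

/-- Geometric decay in mean square implies geometric decay of the bias. -/
theorem norm_integral_sub_le_of_sq_le {Ω H : Type*} [MeasurableSpace Ω] {P : Measure Ω}
    [IsProbabilityMeasure P] [NormedAddCommGroup H] [InnerProductSpace ℝ H] [CompleteSpace H]
    {X : Ω → H} (hX : MemLp X 2 P) (z : H) {K t : ℝ} (ht : 0 < t)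
    (h : ∫ ω, ‖X ω - z‖ ^ 2 ∂P ≤ K * t ^ 2) : ‖(∫ ω, X ω ∂P) - z‖ ≤ (K + 1) / 2 * t := by
  have hXz : MemLp (fun ω => X ω - z) 2 P := hX.sub (memLp_const z)
  have hX1 : Integrable X P := hX.integrable one_le_two
  have h1 : (∫ ω, X ω ∂P) - z = ∫ ω, (X ω - z) ∂P := by
    rw [integral_sub hX1 (integrable_const z), integral_const, probReal_univ, one_smul]
  rw [h1]
  -- The majorant comes from a ≤ a²/(2t) + t/2; with t of the order of the root mean square it
  -- yields a bound linear in t.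
  have hi : Integrable (fun ω => ‖X ω - z‖ ^ 2 * (2 * t)⁻¹ + t / 2) P :=
    (hXz.integrable_norm_sq.mul_const _).add (integrable_const _)
  calc ‖∫ ω, (X ω - z) ∂P‖ ≤ ∫ ω, ‖X ω - z‖ ∂P := norm_integral_le_integral_norm _
    _ ≤ ∫ ω, (‖X ω - z‖ ^ 2 * (2 * t)⁻¹ + t / 2) ∂P := by
      refine integral_mono (hXz.integrable one_le_two).norm hi fun ω => ?_
      have h2 : ‖X ω - z‖ ^ 2 * (2 * t)⁻¹ + t / 2 - ‖X ω - z‖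
          = (‖X ω - z‖ - t) ^ 2 * (2 * t)⁻¹ := by field_simp; ring
      have h3 : 0 ≤ (‖X ω - z‖ - t) ^ 2 * (2 * t)⁻¹ := by positivity
      show ‖X ω - z‖ ≤ ‖X ω - z‖ ^ 2 * (2 * t)⁻¹ + t / 2
      linarith
    _ = (∫ ω, ‖X ω - z‖ ^ 2 ∂P) * (2 * t)⁻¹ + t / 2 := by
      rw [integral_add (hXz.integrable_norm_sq.mul_const _) (integrable_const _),
        integral_mul_const, integral_const, probReal_univ, one_smul]
    _ ≤ K * t ^ 2 * (2 * t)⁻¹ + t / 2 := by gcongr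
    _ = (K + 1) / 2 * t := by field_simp

theorem corollary1 {n d : ℕ}
    (G : SimpleGraph (Fin n)) [DecidableRel G.Adj]
    (hconn : G.Connected) (hpd : (CCDQM.unsignedLap G).PosDef)
    (f : Fin n → CCDQM.Vec d → ℝ) (v ℓ : Fin n → ℝ)
    (hf : ∀ i, CCDQM.StronglyConvexSmooth (f i) (v i) (ℓ i))
    {S : Type u} [MeasurableSpace S] (ν : Measure S) [IsProbabilityMeasure ν]
    (C : S → CCDQM.Vec d → CCDQM.Vec d) (δ : ℝ)
    (hC : CCDQM.IsContractive ν C δ) (hunb : CCDQM.IsUnbiased ν C)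
    (hδ : δ / (1 - √δ) ^ 2 < CCDQM.unsignedLapEigMin G / (3 * CCDQM.lapEigMax G))
    (c : ℝ)
    (hc : (⨆ i, ℓ i) ^ 2 / (⨅ i, v i) *
        (2 * (1 - √δ) ^ 2 /
          (CCDQM.unsignedLapEigMin G * (1 - √δ) ^ 2 - 3 * CCDQM.lapEigMax G * δ)) < c)
    (μ : ℕ → ℝ) (hμ : ∀ k, μ k = 0) :
    ∃ xopt : CCDQM.Vec d,
      CCDQM.IsOptimal f xopt ∧ (∀ z, CCDQM.IsOptimal f z → z = xopt) ∧
      ∃ σ : ℝ, 0 < σ ∧ σ < 1 ∧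
        ∀ (Ω : Type w) [mΩ : MeasurableSpace Ω] (P : Measure Ω) [IsProbabilityMeasure P]
          (ℱ : Filtration ℕ mΩ) (x0 : Fin n → Ω → CCDQM.Vec d) (ξ : ℕ → Fin n → Ω → S),
          CCDQM.IsRandomInput ν P ℱ x0 ξ →
          ∃ K : ℝ, ∀ (k : ℕ) (i : Fin n),
            let X : Ω → CCDQM.Vec d := fun ω =>
              (CCDQM.run G f c C μ (fun j => x0 j ω) (fun m j => ξ m j ω) k).x i
            MemLp X 2 P ∧
              ‖(∫ ω, X ω ∂P) - xopt‖ ≤ K * σ ^ k ∧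
              ∫ ω, ‖X ω - xopt‖ ^ 2 ∂P ≤ K * σ ^ k := by
  have hne : Nonempty (Fin n) := hconn.nonempty
  have : NeZero n := ⟨fun h => by subst h; exact hne.elim fun i => i.elim0⟩
  obtain ⟨xopt, hopt, huniq, hgrad⟩ := CCDQM.exists_isOptimal hf
  refine ⟨xopt, hopt, huniq, ?_⟩
  set s := √δ with hs
  have hsq : s ^ 2 = δ := Real.sq_sqrt hC.nonneg
  have hs0 : 0 ≤ s := Real.sqrt_nonneg δ
  have hs1 : s < 1 := by
    rw [hs, Real.sqrt_lt' one_pos, one_pow]; exact hC.lt_one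
  have h1s : 0 < 1 - s := by linarith
  have hquot : 0 < CCDQM.unsignedLapEigMin G / (3 * CCDQM.lapEigMax G) :=
    lt_of_le_of_lt (div_nonneg hC.nonneg (sq_nonneg _)) hδ
  have hlam : 0 < CCDQM.lapEigMax G := by
    -- If λ_n were 0, the right side of the condition on δ would be 0 by the convention for division
    -- by zero, and no δ ≥ 0 would satisfy it.
    refine lt_of_le_of_ne CCDQM.lapEigMax_nonneg fun h => ?_
    rw [← h, mul_zero, div_zero] at hquot
    exact lt_irrefl _ hquot
  have hmu : 0 < CCDQM.unsignedLapEigMin G :=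
    (div_pos_iff_of_pos_right (by positivity)).1 hquot
  have hD : 0 < CCDQM.unsignedLapEigMin G * (1 - s) ^ 2 - 3 * CCDQM.lapEigMax G * δ := by
    rw [div_lt_div_iff₀ (by positivity) (by positivity)] at hδ
    linarith
  have hv : ∀ i, (⨅ i, v i) ≤ v i := fun i => ciInf_le (Set.finite_range _).bddBelow i
  have hv0 : 0 < ⨅ i, v i := by
    obtain ⟨i, hi⟩ := exists_eq_ciInf_of_finite (f := v)
    rw [← hi]; exact (hf i).modulus_pos
  -- For d = 0 the Lipschitz constants may be negative; the absolute value gives a nonnegative bound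
  -- with the same square.
  have hl : ∀ i, ℓ i ≤ |⨆ i, ℓ i| := fun i =>
    (le_ciSup (Set.finite_range _).bddAbove i).trans (le_abs_self _)
  have hc0 : 0 < c := lt_of_le_of_lt (by positivity) hc
  have hcond : |⨆ i, ℓ i| ^ 2 < (⨅ i, v i) * (c / 2 * (CCDQM.unsignedLapEigMin G
      - 3 * CCDQM.lapEigMax G * (s ^ 2 / (1 - s) ^ 2))) := by
    -- After clearing denominators, the lower bound on c is exactly the positive definiteness of the
    -- quadratic form in the contraction.
    rw [div_mul_div_comm, div_lt_iff₀ (by positivity)] at hc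
    have h2 : (⨅ i, v i) * (c / 2 * (CCDQM.unsignedLapEigMin G
        - 3 * CCDQM.lapEigMax G * (s ^ 2 / (1 - s) ^ 2)))
        = c * ((⨅ i, v i) * (CCDQM.unsignedLapEigMin G * (1 - s) ^ 2
          - 3 * CCDQM.lapEigMax G * δ)) / (2 * (1 - s) ^ 2) := by
      rw [← hsq]; field_simp
    rw [h2, lt_div_iff₀ (by positivity), sq_abs]
    exact hc
  obtain ⟨r, hr0, hr1, hrate⟩ := CCDQM.exists_rate (μ := μ) hconn hf hv0 hv (abs_nonneg _) hl hs0
    hs1 hc0 hlam hmu hcond hgrad (hsq ▸ hC) hunb hμ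
  -- The second moment decays like r^k and the bias like its square root, so √r serves for both.
  refine ⟨√r, Real.sqrt_pos.2 hr0, by rwa [Real.sqrt_lt' one_pos, one_pow], ?_⟩
  intro Ω mΩ P _ ℱ x0 ξ hin
  obtain ⟨K, hK⟩ := hrate Ω P ℱ x0 ξ hin
  refine ⟨|K| + 1, fun k i => ?_⟩
  have hmem := (CCDQM.isAdaptedL2_run (G := G) hf hc0.le hC hμ hin k).memLp_x i
  have hσ0 : 0 < √r ^ k := pow_pos (Real.sqrt_pos.2 hr0) k
  have hσ1 : √r ^ k ≤ 1 := pow_le_one₀ (Real.sqrt_nonneg r) (Real.sqrt_le_one.2 hr1.le)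
  have hσ2 : r ^ k = (√r ^ k) ^ 2 := by rw [← pow_mul, mul_comm, pow_mul, Real.sq_sqrt hr0.le]
  have hsqle := (hK k i).trans (mul_le_mul_of_nonneg_right (le_abs_self K) (pow_nonneg hr0.le k))
  rw [hσ2] at hsqle
  refine ⟨hmem, (norm_integral_sub_le_of_sq_le hmem xopt hσ0 hsqle).trans ?_, hsqle.trans ?_⟩
  · refine mul_le_mul_of_nonneg_right ?_ hσ0.le
    linarith [abs_nonneg K]
  · have h3 : (√r ^ k) ^ 2 ≤ √r ^ k := by rw [sq]; exact mul_le_of_le_one_left hσ0.le hσ1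
    calc |K| * (√r ^ k) ^ 2 ≤ |K| * √r ^ k := by gcongr
      _ ≤ (|K| + 1) * √r ^ k := by gcongr; linarith
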